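/- \textbf{The game.} A deck has four cards $A>K>Q>J$; each of three players is dealt one card, all 24 deals being equally likely. There is a pot of $P\ge 2$ units. Player 1 checks or bets one unit; if Player 1 checks, Player 2 checks or bets; if both check, Player 3 checks or bets. After a bet the other two players, in order of seating after the bettor, each call (one unit) or fold. The highest card among the players who have not folded takes the pot and all bets. A holder of $J$ always checks and folds; a holder of $K$ never bets; a holder of $Q$ never calls; after a bet and a call the last player calls exactly with $A$; a holder of $A$ always calls a bet; after two checks Player 3 always bets with $A$. The eleven remaining frequencies in $[0,1]$ are: $a_1,a_2$ (betting with $A$), $b_1,b_2,b_3$ (betting with $Q$), $c_1,c_2,c_3$ (calling with $K$ directly after a bet) and $d_1,d_2,d_3$ (calling with $K$ after a bet and a fold), where the index is the player. The expected profit of a player is the mean, over the deals and the play, of what she takes minus what she puts in, the initial pot counting as contributed in equal shares $P/3$. A (Nash) equilibrium is a choice of the eleven frequencies such that no player can increase her own expected profit by changing only her own frequencies. \textbf{The families.} Put $B=P+1$, $L=\frac{2P-4}{B}$ and $$P_3=\tfrac{3+\sqrt{97}}4,\quad P_4=\tfrac{3+\sqrt{15}}2,\quad P_6=\tfrac{3+\sqrt{23}}2,\quad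 P_8=\tfrac{7+\sqrt{105}}4,\quad P_9=\tfrac{7+\sqrt{113}}4 .$$ All frequencies are required to lie in $[0,1]$; those not mentioned are otherwise unrestricted. \begin{itemize} \item \textbf{1}, $2\le P\le 3$: $a_1=b_1=a_2=b_2=0$, $b_3=\frac2B$, $c_1=0$, $d_2=L$, $L\le c_3+d_1\le\frac2B$, $L\le c_2+d_3\le\frac2B$. \item \textbf{2}, $3\le P\le P_4$: $a_1=b_1=0$, $a_2=\frac12$, $b_2=\frac1B$, $b_3=\frac2B$, $c_1=2P-6$, $d_2=\frac{3+6P-2P^2}{B}$, $c_3=0$, $d_1=L$, $L\le c_2+d_3\le\frac3B$. \item \textbf{3}, $P_3\le P\le P_4$: $a_1=b_1=0$, $a_2=\frac12\left(4-P^2+\sqrt{P^4-4P^3+4P^2+12P+12}\right)$, $b_2=\frac{2a_2}{B}$, $b_3=\frac{2-b_2}{P+a_2}$, $c_1=\frac{2P-4+2a_2}{B}$, $d_2=0$, $c_3=0$, $d_1=L$, $L\le c_2+d_3\le b_2+b_3$. \item \textbf{4}, $P_3\le P\le\frac72$: $a_1=b_1=0$, $a_2=\frac12(5-P)$, $b_2=\frac{5-P}{B}$,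 $b_3=\frac{4(P-2)}{3B}$, $c_1=1$, $d_2=0$, $c_3=0$, $d_1=L$, $L\le c_2+d_3\le\frac{P+7}{3B}$. \item \textbf{5}, $\frac72\le P\le4$: $a_1=b_1=0$, $a_2=1$, $b_2=b_3=\frac2B$, $c_1=1$, $d_2=\frac{P-3}{B}$, $c_3=0$, $d_1=L$, $L\le c_2+d_3\le\frac4B$. \item \textbf{6}, $P_6\le P\le4$: $a_1=(4-P)B$, $b_1=2(4-P)$, $a_2=1$, $b_2=\frac2B$, $b_3=\frac{2(P-3)}{B}$, $c_1=1$, $d_2=\frac{5+7P-2P^2}{B}$, $c_3=0$, $d_1=\frac{4+8P-2P^2}{B}$, $c_2=0$, $d_3=L$. \item \textbf{7}, $P_6\le P\le P_9$: $a_1=\frac12$, $b_1=\frac1B$, $a_2=1$, $b_2=\frac2B$, $b_3=\frac{2P+1}{B^2}$, $c_1=1$, $d_2=\frac{P-2}{B}$, $c_3=\frac{2P^2-6P-7}{B}$, $d_1=\frac{4+8P-2P^2}{B}$, $c_2=0$, $d_3=L$. \item \textbf{8}, $P_8\le P\le P_9$: $a_1=\frac12(9-2P)B$, $b_1=9-2P$,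 $a_2=1$, $b_2=\frac2B$, $b_3=\frac{2P-7}{B}$, $c_1=1$, $d_2=\frac{6+8P-2P^2}{B}$, $c_3=1$, $d_1=\frac{4+8P-2P^2}{B}$, $c_2=0$, $d_3=L$. \item \textbf{9}, $P_8\le P\le5$: $a_1=1$, $b_1=\frac2B$, $a_2=1$, $b_2=\frac2B$, $b_3=\frac{2P}{B^2}$, $c_1+d_2=\frac{2P}{B}$, $c_3=1$, $d_1=\frac{P-3}{B}$, $c_2=0$, $d_3=L$. \item \textbf{10}, $P\ge5$: $a_1=1$, $b_1=\frac2P$, $a_2=1$, $b_2=\frac2B$, $b_3=\frac{2P}{B^2}$, $c_1=\frac{P-1}{B}$, $d_2=1$, $c_3=1$, $d_1=\frac{P-3}{B}$, $c_2=\frac{P-5}{B}$, $d_3=1$. \end{itemize} \textbf{The special sets.} \begin{itemize} \item \textbf{1a}, $P=2$: $a_1=b_1=a_2=b_2=0$, $0\le b_3\le\frac23$, $c_1=d_2=0$, $c_3+d_1\le b_3$, $c_2+d_3\le b_3$. \item \textbf{2a}, $P=3$: $a_1=b_1=0$, $b_2=\frac12a_2$, $a_2\le\frac12$, $b_3=\frac12$,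 $c_1=0$, $d_2=\frac12(1+a_2)$, $c_3=0$, $d_1=\frac12$, $\frac12\le c_2+d_3\le\frac12+b_2$. \item \textbf{5a}, $P=\frac72$: $a_1=b_1=0$, $b_2=\frac49a_2$, $a_2\ge\frac34$, $b_3=\frac49$, $c_1=1$, $d_2=\frac49a_2-\frac13$, $c_3=0$, $d_1=\frac23$, $\frac23\le c_2+d_3\le\frac49(1+a_2)$. \item \textbf{10a}, $P=5$: $a_1=1$, $\frac13\le b_1\le\frac25$, $a_2=1$, $b_2=\frac13$, $b_3=\frac5{18}$, $c_1+d_2=\frac53$ if $b_1=\frac13$, $c_1=\frac23$ and $d_2=1$ if $b_1>\frac13$, $c_3=1$, $d_1=\frac13$, $c_2=0$, $d_3=1$. \end{itemize} \textbf{Theorem.} Let $P\ge2$. \begin{enumerate} \item The equilibria at pot size $P$ are exactly the members of those families among 1--10 whose stated interval contains $P$, together with the special sets 1a, 2a, 5a, 10a when $P$ equals $2$, $3$, $\frac72$, $5$ respectively. \item The intervals are the exact ranges of validity: if $P$ lies in the interval of a family, then its formulas define a nonempty set of equilibria; if $P$ does not, then no choice of frequencies in $[0,1]$ that satisfies its formulas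 is an equilibrium. \item For $P_3<P<P_4$ the set of equilibria is the union of families 2, 3, 4; for $P_6<P<4$ it is the union of families 5, 6, 7; for $P_8<P<P_9$ it is the union of families 7, 8, 9. In each case the three families are nonempty and pairwise disjoint. For no other $P\ge 2$ are there three pairwise disjoint families among those of 1--10 whose interval contains $P$. \end{enumerate} -/

import Mathlib

namespace Kuhn

/-- The four cards of the deck. -/
inductive Card where
  | J | Q | K | A
  deriving DecidableEq

instance : Fintype Card where
  elems := {.J, .Q, .K, .A}
  complete := by intro x; cases x <;> decide

/-- The rank of a card: `J < Q < K < A`. -/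
def Card.rank : Card → ℕ
  | .J => 0
  | .Q => 1
  | .K => 2
  | .A => 3

/-- The eleven free frequencies. For player `i`: `aᵢ` is the probability of betting with `A`,
`bᵢ` of betting with `Q`, `cᵢ` of calling with `K` directly after a bet, `dᵢ` of calling with `K`
after a bet and a fold. (Player 3 always bets with `A` after two checks, so there is no `a₃`.) -/
@[ext]
structure Profile where
  a₁ : ℝ
  b₁ : ℝ
  c₁ : ℝ
  d₁ : ℝ
  a₂ : ℝ
  b₂ : ℝ
  c₂ : ℝ
  d₂ : ℝ
  b₃ : ℝ
  c₃ : ℝ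
  d₃ : ℝ

/-- All frequencies are probabilities. -/
def Profile.Feasible (σ : Profile) : Prop :=
  σ.a₁ ∈ Set.Icc (0 : ℝ) 1 ∧ σ.b₁ ∈ Set.Icc (0 : ℝ) 1 ∧ σ.c₁ ∈ Set.Icc (0 : ℝ) 1 ∧
  σ.d₁ ∈ Set.Icc (0 : ℝ) 1 ∧ σ.a₂ ∈ Set.Icc (0 : ℝ) 1 ∧ σ.b₂ ∈ Set.Icc (0 : ℝ) 1 ∧
  σ.c₂ ∈ Set.Icc (0 : ℝ) 1 ∧ σ.d₂ ∈ Set.Icc (0 : ℝ) 1 ∧ σ.b₃ ∈ Set.Icc (0 : ℝ) 1 ∧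
  σ.c₃ ∈ Set.Icc (0 : ℝ) 1 ∧ σ.d₃ ∈ Set.Icc (0 : ℝ) 1

/-- The probability of the active move (bet or call) at a decision node labelled `(q, k, a)`,
for a player holding the given card. A player holding `J` always checks or folds. -/
def freq (q k a : ℝ) : Card → ℝ
  | .J => 0
  | .Q => q
  | .K => k
  | .A => a

/-- Net profit of player `i` at a terminal node where the players in `S` have not folded and each
of them has put in `stake`, the others nothing: the highest unfolded card takes the pot `P` and
all stakes. The initial pot of `P` is regarded as having been contributed in equal shares. -/
noncomputable def payoff (P : ℝ) (deal : Fin 3 → Card) (stake : ℝ) (S : Finset (Fin 3))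
    (i : Fin 3) : ℝ :=
  (if i ∈ S ∧ ∀ j ∈ S, (deal j).rank ≤ (deal i).rank then P + stake * (S.card : ℝ) else 0)
    - (if i ∈ S then stake else 0) - P / 3

/-- A random move: `u` with probability `p`, `v` with probability `1 - p`. -/
def mix (p u v : ℝ) : ℝ := p * u + (1 - p) * v

/-- Expected net profit of player `i` for a given deal, obtained from the decision tree of the
game. Player 1, 2, 3 is `0`, `1`, `2 : Fin 3`. At each node the first branch is bet or call, the
second is check or fold. -/
noncomputable def dealValue (P : ℝ) (σ : Profile) (deal : Fin 3 → Card) (i : Fin 3) : ℝ :=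
  -- player 1 opens
  mix (freq σ.b₁ 0 σ.a₁ (deal 0))
    -- player 1 has bet; players 2 and 3 respond
    (mix (freq 0 σ.c₂ 1 (deal 1))
      (mix (freq 0 0 1 (deal 2)) (payoff P deal 1 {0, 1, 2} i) (payoff P deal 1 {0, 1} i))
      (mix (freq 0 σ.d₃ 1 (deal 2)) (payoff P deal 1 {0, 2} i) (payoff P deal 1 {0} i)))
    -- player 1 has checked; player 2 acts
    (mix (freq σ.b₂ 0 σ.a₂ (deal 1))
      -- player 2 has bet; players 3 and 1 respond
      (mix (freq 0 σ.c₃ 1 (deal 2))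
        (mix (freq 0 0 1 (deal 0)) (payoff P deal 1 {0, 1, 2} i) (payoff P deal 1 {1, 2} i))
        (mix (freq 0 σ.d₁ 1 (deal 0)) (payoff P deal 1 {0, 1} i) (payoff P deal 1 {1} i)))
      -- players 1 and 2 have checked; player 3 acts
      (mix (freq σ.b₃ 0 1 (deal 2))
        -- player 3 has bet; players 1 and 2 respond
        (mix (freq 0 σ.c₁ 1 (deal 0))
          (mix (freq 0 0 1 (deal 1)) (payoff P deal 1 {0, 1, 2} i) (payoff P deal 1 {0, 2} i))
          (mix (freq 0 σ.d₂ 1 (deal 1)) (payoff P deal 1 {1, 2} i) (payoff P deal 1 {2} i)))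
        -- everyone has checked
        (payoff P deal 0 {0, 1, 2} i)))

/-- Expected profit of player `i`: the average over the 24 equally likely deals. -/
noncomputable def expectedProfit (P : ℝ) (σ : Profile) (i : Fin 3) : ℝ :=
  (1 / 24) * ∑ x : Card, ∑ y : Card, ∑ z : Card,
    if x ≠ y ∧ x ≠ z ∧ y ≠ z then dealValue P σ ![x, y, z] i else 0

/-- A Nash equilibrium: no player can gain by changing her own frequencies. -/
def IsNash (P : ℝ) (σ : Profile) : Prop :=
  σ.Feasible ∧
  (∀ a ∈ Set.Icc (0 : ℝ) 1, ∀ b ∈ Set.Icc (0 : ℝ) 1, ∀ c ∈ Set.Icc (0 : ℝ) 1,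
    ∀ d ∈ Set.Icc (0 : ℝ) 1,
    expectedProfit P { σ with a₁ := a, b₁ := b, c₁ := c, d₁ := d } 0 ≤ expectedProfit P σ 0) ∧
  (∀ a ∈ Set.Icc (0 : ℝ) 1, ∀ b ∈ Set.Icc (0 : ℝ) 1, ∀ c ∈ Set.Icc (0 : ℝ) 1,
    ∀ d ∈ Set.Icc (0 : ℝ) 1,
    expectedProfit P { σ with a₂ := a, b₂ := b, c₂ := c, d₂ := d } 1 ≤ expectedProfit P σ 1) ∧
  (∀ b ∈ Set.Icc (0 : ℝ) 1, ∀ c ∈ Set.Icc (0 : ℝ) 1, ∀ d ∈ Set.Icc (0 : ℝ) 1,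
    expectedProfit P { σ with b₃ := b, c₃ := c, d₃ := d } 2 ≤ expectedProfit P σ 2)

/-- The set of Nash equilibria at pot size `P`. -/
def nashSet (P : ℝ) : Set Profile := {σ | IsNash P σ}

noncomputable def P₃ : ℝ := (3 + √97) / 4
noncomputable def P₄ : ℝ := (3 + √15) / 2
noncomputable def P₆ : ℝ := (3 + √23) / 2
noncomputable def P₈ : ℝ := (7 + √105) / 4
noncomputable def P₉ : ℝ := (7 + √113) / 4

/-! The ten solution families, given by their formulas at an arbitrary `P`; the interval of pot
sizes on which each one is valid is recorded separately in `validRange`. -/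

def solution1 (P : ℝ) : Set Profile := {σ | σ.Feasible ∧
  σ.a₁ = 0 ∧ σ.b₁ = 0 ∧ σ.a₂ = 0 ∧ σ.b₂ = 0 ∧ σ.b₃ = 2 / (P + 1) ∧ σ.c₁ = 0 ∧
  σ.d₂ = (2 * P - 4) / (P + 1) ∧
  (2 * P - 4) / (P + 1) ≤ σ.c₃ + σ.d₁ ∧ σ.c₃ + σ.d₁ ≤ 2 / (P + 1) ∧
  (2 * P - 4) / (P + 1) ≤ σ.c₂ + σ.d₃ ∧ σ.c₂ + σ.d₃ ≤ 2 / (P + 1)}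

def solution2 (P : ℝ) : Set Profile := {σ | σ.Feasible ∧
  σ.a₁ = 0 ∧ σ.b₁ = 0 ∧ σ.a₂ = 1 / 2 ∧ σ.b₂ = 1 / (P + 1) ∧ σ.b₃ = 2 / (P + 1) ∧
  σ.c₁ = 2 * P - 6 ∧ σ.d₂ = (3 + 6 * P - 2 * P ^ 2) / (P + 1) ∧ σ.c₃ = 0 ∧
  σ.d₁ = (2 * P - 4) / (P + 1) ∧
  (2 * P - 4) / (P + 1) ≤ σ.c₂ + σ.d₃ ∧ σ.c₂ + σ.d₃ ≤ 3 / (P + 1)}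

def solution3 (P : ℝ) : Set Profile := {σ | σ.Feasible ∧
  σ.a₁ = 0 ∧ σ.b₁ = 0 ∧
  σ.a₂ = (1 / 2) * (4 - P ^ 2 + √(P ^ 4 - 4 * P ^ 3 + 4 * P ^ 2 + 12 * P + 12)) ∧
  σ.b₂ = 2 * σ.a₂ / (P + 1) ∧ σ.b₃ = (2 - σ.b₂) / (P + σ.a₂) ∧
  σ.c₁ = (2 * P - 4 + 2 * σ.a₂) / (P + 1) ∧ σ.d₂ = 0 ∧ σ.c₃ = 0 ∧
  σ.d₁ = (2 * P - 4) / (P + 1) ∧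
  (2 * P - 4) / (P + 1) ≤ σ.c₂ + σ.d₃ ∧ σ.c₂ + σ.d₃ ≤ σ.b₂ + σ.b₃}

def solution4 (P : ℝ) : Set Profile := {σ | σ.Feasible ∧
  σ.a₁ = 0 ∧ σ.b₁ = 0 ∧ σ.a₂ = (1 / 2) * (5 - P) ∧ σ.b₂ = (5 - P) / (P + 1) ∧
  σ.b₃ = 4 * (P - 2) / (3 * (P + 1)) ∧ σ.c₁ = 1 ∧ σ.d₂ = 0 ∧ σ.c₃ = 0 ∧
  σ.d₁ = (2 * P - 4) / (P + 1) ∧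
  (2 * P - 4) / (P + 1) ≤ σ.c₂ + σ.d₃ ∧ σ.c₂ + σ.d₃ ≤ (P + 7) / (3 * (P + 1))}

def solution5 (P : ℝ) : Set Profile := {σ | σ.Feasible ∧
  σ.a₁ = 0 ∧ σ.b₁ = 0 ∧ σ.a₂ = 1 ∧ σ.b₂ = 2 / (P + 1) ∧ σ.b₃ = 2 / (P + 1) ∧
  σ.c₁ = 1 ∧ σ.d₂ = (P - 3) / (P + 1) ∧ σ.c₃ = 0 ∧ σ.d₁ = (2 * P - 4) / (P + 1) ∧
  (2 * P - 4) / (P + 1) ≤ σ.c₂ + σ.d₃ ∧ σ.c₂ + σ.d₃ ≤ 4 / (P + 1)}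

def solution6 (P : ℝ) : Set Profile := {σ | σ.Feasible ∧
  σ.a₁ = (4 - P) * (P + 1) ∧ σ.b₁ = 2 * (4 - P) ∧ σ.a₂ = 1 ∧ σ.b₂ = 2 / (P + 1) ∧
  σ.b₃ = 2 * (P - 3) / (P + 1) ∧ σ.c₁ = 1 ∧
  σ.d₂ = (5 + 7 * P - 2 * P ^ 2) / (P + 1) ∧ σ.c₃ = 0 ∧
  σ.d₁ = (4 + 8 * P - 2 * P ^ 2) / (P + 1) ∧ σ.c₂ = 0 ∧ σ.d₃ = (2 * P - 4) / (P + 1)}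

def solution7 (P : ℝ) : Set Profile := {σ | σ.Feasible ∧
  σ.a₁ = 1 / 2 ∧ σ.b₁ = 1 / (P + 1) ∧ σ.a₂ = 1 ∧ σ.b₂ = 2 / (P + 1) ∧
  σ.b₃ = (2 * P + 1) / (P + 1) ^ 2 ∧ σ.c₁ = 1 ∧ σ.d₂ = (P - 2) / (P + 1) ∧
  σ.c₃ = (2 * P ^ 2 - 6 * P - 7) / (P + 1) ∧
  σ.d₁ = (4 + 8 * P - 2 * P ^ 2) / (P + 1) ∧ σ.c₂ = 0 ∧ σ.d₃ = (2 * P - 4) / (P + 1)}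

def solution8 (P : ℝ) : Set Profile := {σ | σ.Feasible ∧
  σ.a₁ = (1 / 2) * (9 - 2 * P) * (P + 1) ∧ σ.b₁ = 9 - 2 * P ∧ σ.a₂ = 1 ∧
  σ.b₂ = 2 / (P + 1) ∧ σ.b₃ = (2 * P - 7) / (P + 1) ∧ σ.c₁ = 1 ∧
  σ.d₂ = (6 + 8 * P - 2 * P ^ 2) / (P + 1) ∧ σ.c₃ = 1 ∧
  σ.d₁ = (4 + 8 * P - 2 * P ^ 2) / (P + 1) ∧ σ.c₂ = 0 ∧ σ.d₃ = (2 * P - 4) / (P + 1)}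

def solution9 (P : ℝ) : Set Profile := {σ | σ.Feasible ∧
  σ.a₁ = 1 ∧ σ.b₁ = 2 / (P + 1) ∧ σ.a₂ = 1 ∧ σ.b₂ = 2 / (P + 1) ∧
  σ.b₃ = 2 * P / (P + 1) ^ 2 ∧ σ.c₁ + σ.d₂ = 2 * P / (P + 1) ∧ σ.c₃ = 1 ∧
  σ.d₁ = (P - 3) / (P + 1) ∧ σ.c₂ = 0 ∧ σ.d₃ = (2 * P - 4) / (P + 1)}

def solution10 (P : ℝ) : Set Profile := {σ | σ.Feasible ∧
  σ.a₁ = 1 ∧ σ.b₁ = 2 / P ∧ σ.a₂ = 1 ∧ σ.b₂ = 2 / (P + 1) ∧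
  σ.b₃ = 2 * P / (P + 1) ^ 2 ∧ σ.c₁ = (P - 1) / (P + 1) ∧ σ.d₂ = 1 ∧ σ.c₃ = 1 ∧
  σ.d₁ = (P - 3) / (P + 1) ∧ σ.c₂ = (P - 5) / (P + 1) ∧ σ.d₃ = 1}

/-- The special equilibria at `P = 2`. -/
def solution1a : Set Profile := {σ | σ.Feasible ∧
  σ.a₁ = 0 ∧ σ.b₁ = 0 ∧ σ.a₂ = 0 ∧ σ.b₂ = 0 ∧ 0 ≤ σ.b₃ ∧ σ.b₃ ≤ 2 / 3 ∧
  σ.c₁ = 0 ∧ σ.d₂ = 0 ∧ σ.c₃ + σ.d₁ ≤ σ.b₃ ∧ σ.c₂ + σ.d₃ ≤ σ.b₃}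

/-- The special equilibria at `P = 3`. -/
def solution2a : Set Profile := {σ | σ.Feasible ∧
  σ.a₁ = 0 ∧ σ.b₁ = 0 ∧ σ.b₂ = (1 / 2) * σ.a₂ ∧ σ.a₂ ≤ 1 / 2 ∧ σ.b₃ = 1 / 2 ∧
  σ.c₁ = 0 ∧ σ.d₂ = (1 / 2) * (1 + σ.a₂) ∧ σ.c₃ = 0 ∧ σ.d₁ = 1 / 2 ∧
  1 / 2 ≤ σ.c₂ + σ.d₃ ∧ σ.c₂ + σ.d₃ ≤ 1 / 2 + σ.b₂}

/-- The special equilibria at `P = 7 / 2`. -/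
def solution5a : Set Profile := {σ | σ.Feasible ∧
  σ.a₁ = 0 ∧ σ.b₁ = 0 ∧ σ.b₂ = (4 / 9) * σ.a₂ ∧ 3 / 4 ≤ σ.a₂ ∧ σ.b₃ = 4 / 9 ∧
  σ.c₁ = 1 ∧ σ.d₂ = (4 / 9) * σ.a₂ - 1 / 3 ∧ σ.c₃ = 0 ∧ σ.d₁ = 2 / 3 ∧
  2 / 3 ≤ σ.c₂ + σ.d₃ ∧ σ.c₂ + σ.d₃ ≤ (4 / 9) * (1 + σ.a₂)}

/-- The special equilibria at `P = 5`. -/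
def solution10a : Set Profile := {σ | σ.Feasible ∧
  σ.a₁ = 1 ∧ 1 / 3 ≤ σ.b₁ ∧ σ.b₁ ≤ 2 / 5 ∧ σ.a₂ = 1 ∧ σ.b₂ = 1 / 3 ∧ σ.b₃ = 5 / 18 ∧
  (σ.b₁ = 1 / 3 → σ.c₁ + σ.d₂ = 5 / 3) ∧ (1 / 3 < σ.b₁ → σ.c₁ = 2 / 3 ∧ σ.d₂ = 1) ∧
  σ.c₃ = 1 ∧ σ.d₁ = 1 / 3 ∧ σ.c₂ = 0 ∧ σ.d₃ = 1}

/-- The labels of the ten solution families. -/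
inductive Label where
  | s1 | s2 | s3 | s4 | s5 | s6 | s7 | s8 | s9 | s10

/-- The ten solution families. -/
noncomputable def family : Label → ℝ → Set Profile
  | .s1 => solution1
  | .s2 => solution2
  | .s3 => solution3
  | .s4 => solution4
  | .s5 => solution5
  | .s6 => solution6
  | .s7 => solution7
  | .s8 => solution8
  | .s9 => solution9
  | .s10 => solution10

/-- The range of validity of each of the ten solution families. -/
noncomputable def validRange : Label → Set ℝ
  | .s1 => Set.Icc 2 3
  | .s2 => Set.Icc 3 P₄
  | .s3 => Set.Icc P₃ P₄
  | .s4 => Set.Icc P₃ (7 / 2)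
  | .s5 => Set.Icc (7 / 2) 4
  | .s6 => Set.Icc P₆ 4
  | .s7 => Set.Icc P₆ P₉
  | .s8 => Set.Icc P₈ P₉
  | .s9 => Set.Icc P₈ 5
  | .s10 => Set.Ici 5

/-- The set of Nash equilibria at `P` is made up of three nonempty, pairwise disjoint families. -/
def ThreeCoexist (P : ℝ) (i j k : Label) : Prop :=
  nashSet P = family i P ∪ family j P ∪ family k P ∧
  (family i P).Nonempty ∧ (family j P).Nonempty ∧ (family k P).Nonempty ∧
  Disjoint (family i P) (family j P) ∧ Disjoint (family i P) (family k P) ∧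
  Disjoint (family j P) (family k P)

end Kuhn

namespace Kuhn

section Classification

/-! In her own frequencies a player's profit is affine without cross terms: each betting frequency
belongs to its own card, and her two calls with `K` lie on different branches of the tree. An
equilibrium is therefore the same as eleven separate sign conditions, the complementarity system
`FirstOrder`: a gain is nonpositive unless its frequency is 1 and nonnegative unless it is 0.

The gain of a bluff depends on the callers only through the total calling frequency against that
bettor: `c₂ + d₃`, `c₃ + d₁` or `c₁ + d₂`. No bluff is made with certainty, so each total has a
lower bound, which is attained once the bluff has positive frequency. How a total splits between its
two callers is decided by the larger calling gain (`BestReply.left_eq_zero`,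
`BestReply.right_eq_one`).

What remains is a case split on the value bets. If `a₁ = 0`, then `b₁ = 0`, and the position of `a₂`
and then of `c₁` in the unit interval leads to families 1 to 5 and the sets 1a, 2a, 5a. If `a₁ > 0`,
the hard facts are `a₂ = 1` (`FirstOrder.a₂_eq_one`) and `(P + 1) * b₂ = 2`
(`FirstOrder.two_le_mul_b₂`, `FirstOrder.mul_b₂_le_two`). Then `a₁ < 1` gives families 6 to 8
according to the sign of `4 * a₁ - 2`, and `a₁ = 1` gives 9, 10a or 10 according to the position of
`P` relative to 5.

Conversely, the formulas of a family make every gain zero or of the right sign. Outside its range a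
frequency leaves the unit interval, an interval of calling totals becomes empty, or a gain has the
wrong sign; the thresholds `P₃` to `P₉` are used only through the equivalent quadratic inequalities.
In the open ranges of triple coexistence a single coordinate separates the families. At each of the
six endpoints one family is contained in another, and elsewhere at most two families are valid. -/

/-- The frequency `v` is a best reply when raising it by one unit gains `g`. -/
def BestReply (g v : ℝ) : Prop := (v < 1 → g ≤ 0) ∧ (0 < v → 0 ≤ g)

/-! ### Reduction of equilibrium to eleven first-order conditions. -/

theorem sum_card (f : Card → ℝ) : ∑ x : Card, f x = f .J + f .Q + f .K + f .A := by
  have : (Finset.univ : Finset Card) = {.J, .Q, .K, .A} := rfl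
  rw [this]
  simp [Finset.sum_insert]
  ring

/-- The factor 24 clears the average over deals. No coefficient contains a frequency of the
deviating player, which is what decouples her four choices; the same holds for the other two
players. -/
theorem expectedProfit_update_zero (P : ℝ) (σ : Profile) (a b c d : ℝ) :
    24 * (expectedProfit P { σ with a₁ := a, b₁ := b, c₁ := c, d₁ := d } 0 -
      expectedProfit P σ 0) =
    (2 * (σ.c₂ + σ.d₃) - 2 * σ.b₂ - 2 * σ.b₃ - σ.b₂ * σ.c₃) * (a - σ.a₁) +
      (2 * P - 4 - (P + 1) * (σ.c₂ + σ.d₃)) * (b - σ.b₁) +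
      (σ.b₂ + (P + σ.a₂) * σ.b₃ - 2) * (c - σ.c₁) +
      ((P + 1) * σ.b₂ - 2 * σ.a₂) * (d - σ.d₁) := by
  simp [expectedProfit, sum_card, dealValue, payoff, freq, mix, Card.rank]
  ring

theorem expectedProfit_update_one (P : ℝ) (σ : Profile) (a b c d : ℝ) :
    24 * (expectedProfit P { σ with a₂ := a, b₂ := b, c₂ := c, d₂ := d } 1 -
      expectedProfit P σ 1) =
    (2 * (σ.c₃ + σ.d₁) - 2 * σ.b₃ - σ.b₁ * σ.c₃ - σ.b₃ * σ.c₁) * (a - σ.a₂) +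
      (2 * P - 4 + 2 * σ.a₁ - (P + 1) * (σ.c₃ + σ.d₁)) * (b - σ.b₂) +
      (P * σ.b₁ - 2 * σ.a₁) * (c - σ.c₂) +
      (σ.b₁ + (P + 1) * σ.b₃ - 2) * (d - σ.d₂) := by
  simp [expectedProfit, sum_card, dealValue, payoff, freq, mix, Card.rank]
  ring

theorem expectedProfit_update_two (P : ℝ) (σ : Profile) (b c d : ℝ) :
    24 * (expectedProfit P { σ with b₃ := b, c₃ := c, d₃ := d } 2 - expectedProfit P σ 2) =
    (2 * P - 4 + 2 * σ.a₁ + 2 * σ.a₂ - (P + 1) * (σ.c₁ + σ.d₂)) * (b - σ.b₃) +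
      ((P + σ.a₁) * σ.b₂ + σ.a₂ * σ.b₁ - 2 * σ.a₂) * (c - σ.c₃) +
      ((P + 1) * σ.b₁ - 2 * σ.a₁) * (d - σ.d₃) := by
  simp [expectedProfit, sum_card, dealValue, payoff, freq, mix, Card.rank]
  ring

theorem BestReply.mul_sub_nonpos {g v t : ℝ} (h : BestReply g v) (hv : v ∈ Set.Icc (0 : ℝ) 1)
    (ht : t ∈ Set.Icc (0 : ℝ) 1) : g * (t - v) ≤ 0 := by
  obtain ⟨h1, h0⟩ := h
  obtain ⟨ht0, ht1⟩ := ht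
  rcases le_total t v with htv | htv
  · rcases htv.eq_or_lt with rfl | htv
    · simp
    · exact mul_nonpos_of_nonneg_of_nonpos (h0 (by linarith)) (by linarith)
  · rcases htv.eq_or_lt with rfl | htv
    · simp
    · exact mul_nonpos_of_nonpos_of_nonneg (h1 (by linarith)) (by linarith)

theorem BestReply.eq_one {g v : ℝ} (h : BestReply g v) (hv : v ≤ 1) (hg : 0 < g) : v = 1 :=
  hv.antisymm (not_lt.1 fun hlt => hg.not_ge (h.1 hlt))

theorem BestReply.eq_zero {g v : ℝ} (h : BestReply g v) (hv : 0 ≤ v) (hg : g < 0) : v = 0 :=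
  le_antisymm (not_lt.1 fun hlt => hg.not_ge (h.2 hlt)) hv

theorem BestReply.gain_eq_zero {g v : ℝ} (h : BestReply g v) (h0 : 0 < v) (h1 : v < 1) : g = 0 :=
  le_antisymm (h.1 h1) (h.2 h0)

theorem bestReply_of_mul_sub_nonpos {g v : ℝ}
    (h : ∀ t ∈ Set.Icc (0 : ℝ) 1, g * (t - v) ≤ 0) : BestReply g v := by
  refine ⟨fun hv => ?_, fun hv => ?_⟩
  · have := h 1 (by simp)
    nlinarith
  · have := h 0 (by simp)
    nlinarith

/-- Feasibility together with the eleven first-order conditions. -/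
structure FirstOrder (P a₁ b₁ c₁ d₁ a₂ b₂ c₂ d₂ b₃ c₃ d₃ : ℝ) : Prop where
  ha₁ : a₁ ∈ Set.Icc (0 : ℝ) 1
  hb₁ : b₁ ∈ Set.Icc (0 : ℝ) 1
  hc₁ : c₁ ∈ Set.Icc (0 : ℝ) 1
  hd₁ : d₁ ∈ Set.Icc (0 : ℝ) 1
  ha₂ : a₂ ∈ Set.Icc (0 : ℝ) 1
  hb₂ : b₂ ∈ Set.Icc (0 : ℝ) 1
  hc₂ : c₂ ∈ Set.Icc (0 : ℝ) 1
  hd₂ : d₂ ∈ Set.Icc (0 : ℝ) 1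
  hb₃ : b₃ ∈ Set.Icc (0 : ℝ) 1
  hc₃ : c₃ ∈ Set.Icc (0 : ℝ) 1
  hd₃ : d₃ ∈ Set.Icc (0 : ℝ) 1
  A₁ : BestReply (2 * (c₂ + d₃) - 2 * b₂ - 2 * b₃ - b₂ * c₃) a₁
  B₁ : BestReply (2 * P - 4 - (P + 1) * (c₂ + d₃)) b₁
  C₁ : BestReply (b₂ + (P + a₂) * b₃ - 2) c₁
  D₁ : BestReply ((P + 1) * b₂ - 2 * a₂) d₁
  A₂ : BestReply (2 * (c₃ + d₁) - 2 * b₃ - b₁ * c₃ - b₃ * c₁) a₂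
  B₂ : BestReply (2 * P - 4 + 2 * a₁ - (P + 1) * (c₃ + d₁)) b₂
  C₂ : BestReply (P * b₁ - 2 * a₁) c₂
  D₂ : BestReply (b₁ + (P + 1) * b₃ - 2) d₂
  B₃ : BestReply (2 * P - 4 + 2 * a₁ + 2 * a₂ - (P + 1) * (c₁ + d₂)) b₃
  C₃ : BestReply ((P + a₁) * b₂ + a₂ * b₁ - 2 * a₂) c₃
  D₃ : BestReply ((P + 1) * b₁ - 2 * a₁) d₃

variable {P a₁ b₁ c₁ d₁ a₂ b₂ c₂ d₂ b₃ c₃ d₃ : ℝ}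

theorem FirstOrder.feasible (h : FirstOrder P a₁ b₁ c₁ d₁ a₂ b₂ c₂ d₂ b₃ c₃ d₃) :
    (Profile.mk a₁ b₁ c₁ d₁ a₂ b₂ c₂ d₂ b₃ c₃ d₃).Feasible :=
  ⟨h.ha₁, h.hb₁, h.hc₁, h.hd₁, h.ha₂, h.hb₂, h.hc₂, h.hd₂, h.hb₃, h.hc₃, h.hd₃⟩

theorem isNash_iff_firstOrder {σ : Profile} : IsNash P σ ↔
    FirstOrder P σ.a₁ σ.b₁ σ.c₁ σ.d₁ σ.a₂ σ.b₂ σ.c₂ σ.d₂ σ.b₃ σ.c₃ σ.d₃ := by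
  constructor
  · rintro ⟨hf, h0, h1, h2⟩
    have hf' := hf
    obtain ⟨ha₁, hb₁, hc₁, hd₁, ha₂, hb₂, hc₂, hd₂, hb₃, hc₃, hd₃⟩ := hf'
    have k0 := fun a b c d => expectedProfit_update_zero P σ a b c d
    have k1 := fun a b c d => expectedProfit_update_one P σ a b c d
    have k2 := fun b c d => expectedProfit_update_two P σ b c d
    refine ⟨ha₁, hb₁, hc₁, hd₁, ha₂, hb₂, hc₂, hd₂, hb₃, hc₃, hd₃,
      ?_, ?_, ?_, ?_, ?_, ?_, ?_, ?_, ?_, ?_, ?_⟩ <;>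
      -- Deviating in one frequency and keeping the others isolates a single gain.
      refine bestReply_of_mul_sub_nonpos fun t ht => ?_
    · linarith [h0 t ht _ hb₁ _ hc₁ _ hd₁, k0 t σ.b₁ σ.c₁ σ.d₁]
    · linarith [h0 _ ha₁ t ht _ hc₁ _ hd₁, k0 σ.a₁ t σ.c₁ σ.d₁]
    · linarith [h0 _ ha₁ _ hb₁ t ht _ hd₁, k0 σ.a₁ σ.b₁ t σ.d₁]
    · linarith [h0 _ ha₁ _ hb₁ _ hc₁ t ht, k0 σ.a₁ σ.b₁ σ.c₁ t]
    · linarith [h1 t ht _ hb₂ _ hc₂ _ hd₂, k1 t σ.b₂ σ.c₂ σ.d₂]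
    · linarith [h1 _ ha₂ t ht _ hc₂ _ hd₂, k1 σ.a₂ t σ.c₂ σ.d₂]
    · linarith [h1 _ ha₂ _ hb₂ t ht _ hd₂, k1 σ.a₂ σ.b₂ t σ.d₂]
    · linarith [h1 _ ha₂ _ hb₂ _ hc₂ t ht, k1 σ.a₂ σ.b₂ σ.c₂ t]
    · linarith [h2 t ht _ hc₃ _ hd₃, k2 t σ.c₃ σ.d₃]
    · linarith [h2 _ hb₃ t ht _ hd₃, k2 σ.b₃ t σ.d₃]
    · linarith [h2 _ hb₃ _ hc₃ t ht, k2 σ.b₃ σ.c₃ t]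
  · intro h
    obtain ⟨ha₁, hb₁, hc₁, hd₁, ha₂, hb₂, hc₂, hd₂, hb₃, hc₃, hd₃⟩ := h.feasible
    refine ⟨h.feasible, fun a ha b hb c hc d hd => ?_, fun a ha b hb c hc d hd => ?_,
      fun b hb c hc d hd => ?_⟩
    · linarith [expectedProfit_update_zero P σ a b c d, h.A₁.mul_sub_nonpos ha₁ ha,
        h.B₁.mul_sub_nonpos hb₁ hb, h.C₁.mul_sub_nonpos hc₁ hc, h.D₁.mul_sub_nonpos hd₁ hd]
    · linarith [expectedProfit_update_one P σ a b c d, h.A₂.mul_sub_nonpos ha₂ ha,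
        h.B₂.mul_sub_nonpos hb₂ hb, h.C₂.mul_sub_nonpos hc₂ hc, h.D₂.mul_sub_nonpos hd₂ hd]
    · linarith [expectedProfit_update_two P σ b c d, h.B₃.mul_sub_nonpos hb₃ hb,
        h.C₃.mul_sub_nonpos hc₃ hc, h.D₃.mul_sub_nonpos hd₃ hd]

/-! ### How callers share their total; no bluff is certain. -/

/-- If the caller with the smaller gain ever called, the other one would have a positive gain and
call always, making the total at least 1. Thus a small total falls entirely on the caller with the
larger gain, and a total of at least 1 uses her up. -/
theorem BestReply.left_eq_zero {g G u v : ℝ} (hu : BestReply g u) (hv : BestReply G v)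
    (hg : g < G) (hu0 : 0 ≤ u) (hv1 : v ≤ 1) (huv : u + v < 1) : u = 0 := by
  by_contra hne
  have hu' : 0 < u := lt_of_le_of_ne hu0 (Ne.symm hne)
  have := hv.eq_one hv1 ((hu.2 hu').trans_lt hg)
  linarith

theorem BestReply.right_eq_one {g G u v : ℝ} (hu : BestReply g u) (hv : BestReply G v)
    (hg : g < G) (hu0 : 0 ≤ u) (hv1 : v ≤ 1) (huv : 1 ≤ u + v) : v = 1 := by
  by_contra hne
  have hv' : v < 1 := lt_of_le_of_ne hv1 hne
  have := hu.eq_zero hu0 (hg.trans_le (hv.1 hv'))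
  linarith

/-- Against a certain bluff the opponent who calls after a fold always calls. If the other one
always called too, the bluff would lose; if not, her own gain would be nonpositive, which the size
of the pot and the profitability of the bluff exclude. The next two lemmas use the same dilemma. -/
theorem FirstOrder.b₁_lt_one (h : FirstOrder P a₁ b₁ c₁ d₁ a₂ b₂ c₂ d₂ b₃ c₃ d₃) (hP : 2 ≤ P) :
    b₁ < 1 := by
  refine lt_of_le_of_ne h.hb₁.2 fun hb => ?_
  subst hb
  have := h.ha₁.2
  have hd₃ := h.D₃.eq_one h.hd₃.2 (by linarith)
  have := h.B₁.2 one_pos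
  obtain ⟨hc0, hc1⟩ := h.hc₂
  subst hd₃
  rcases hc1.lt_or_eq with hc | rfl
  · have := h.C₂.1 hc
    nlinarith
  · linarith

theorem FirstOrder.b₂_lt_one (h : FirstOrder P a₁ b₁ c₁ d₁ a₂ b₂ c₂ d₂ b₃ c₃ d₃) (hP : 2 ≤ P) :
    b₂ < 1 := by
  refine lt_of_le_of_ne h.hb₂.2 fun hb => ?_
  subst hb
  obtain ⟨ha₁0, ha₁1⟩ := h.ha₁
  obtain ⟨ha₂0, ha₂1⟩ := h.ha₂
  have hd₁ := h.D₁.eq_one h.hd₁.2 (by linarith)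
  have hB := h.B₂.2 one_pos
  obtain ⟨hc0, hc1⟩ := h.hc₃
  subst hd₁
  have := mul_nonneg ha₂0 h.hb₁.1
  rcases hc1.lt_or_eq with hc | rfl
  · have := h.C₃.1 hc
    nlinarith
  · linarith

theorem FirstOrder.b₃_lt_one (h : FirstOrder P a₁ b₁ c₁ d₁ a₂ b₂ c₂ d₂ b₃ c₃ d₃) (hP : 2 ≤ P) :
    b₃ < 1 := by
  refine lt_of_le_of_ne h.hb₃.2 fun hb => ?_
  subst hb
  obtain ⟨ha₁0, ha₁1⟩ := h.ha₁
  obtain ⟨ha₂0, ha₂1⟩ := h.ha₂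
  have hd₂ := h.D₂.eq_one h.hd₂.2 (by linarith [h.hb₁.1])
  have hB := h.B₃.2 one_pos
  obtain ⟨hc0, hc1⟩ := h.hc₁
  subst hd₂
  rcases hc1.lt_or_eq with hc | rfl
  · have := h.C₁.1 hc
    nlinarith [h.hb₂.1]
  · linarith

theorem FirstOrder.le_calls₁ (h : FirstOrder P a₁ b₁ c₁ d₁ a₂ b₂ c₂ d₂ b₃ c₃ d₃) (hP : 2 ≤ P) :
    2 * P - 4 ≤ (P + 1) * (c₂ + d₃) := by
  linarith [h.B₁.1 (h.b₁_lt_one hP)]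

theorem FirstOrder.le_calls₂ (h : FirstOrder P a₁ b₁ c₁ d₁ a₂ b₂ c₂ d₂ b₃ c₃ d₃) (hP : 2 ≤ P) :
    2 * P - 4 + 2 * a₁ ≤ (P + 1) * (c₃ + d₁) := by
  linarith [h.B₂.1 (h.b₂_lt_one hP)]

theorem FirstOrder.le_calls₃ (h : FirstOrder P a₁ b₁ c₁ d₁ a₂ b₂ c₂ d₂ b₃ c₃ d₃) (hP : 2 ≤ P) :
    2 * P - 4 + 2 * a₁ + 2 * a₂ ≤ (P + 1) * (c₁ + d₂) := by
  linarith [h.B₃.1 (h.b₃_lt_one hP)]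

/-- A bluff not backed by any value bet is always called by both opponents, and then its gain is `2P
- 4 - 2(P + 1) = -6`. -/
theorem FirstOrder.b₁_eq_zero (h : FirstOrder P 0 b₁ c₁ d₁ a₂ b₂ c₂ d₂ b₃ c₃ d₃) (hP : 2 ≤ P) :
    b₁ = 0 := by
  by_contra hne
  have hb : 0 < b₁ := lt_of_le_of_ne h.hb₁.1 (Ne.symm hne)
  have hd := h.D₃.eq_one h.hd₃.2 (by nlinarith)
  have hc := h.C₂.eq_one h.hc₂.2 (by nlinarith)
  have := h.B₁.2 hb
  subst hd hc
  linarith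

/-- If Player 3 never bluffs, nobody calls her with `K`. -/
theorem FirstOrder.calls₃_eq_zero (h : FirstOrder P a₁ b₁ c₁ d₁ a₂ b₂ c₂ d₂ 0 c₃ d₃)
    (hP : 2 ≤ P) : c₁ = 0 ∧ d₂ = 0 :=
  ⟨h.C₁.eq_zero h.hc₁.1 (by linarith [h.b₂_lt_one hP]),
    h.D₂.eq_zero h.hd₂.1 (by linarith [h.b₁_lt_one hP])⟩

theorem FirstOrder.b₃_pos (h : FirstOrder P a₁ b₁ c₁ d₁ a₂ b₂ c₂ d₂ b₃ c₃ d₃) (hP : 2 ≤ P)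
    (hpos : 0 < 2 * P - 4 + 2 * a₁ + 2 * a₂) : 0 < b₃ := by
  refine lt_of_le_of_ne h.hb₃.1 fun hb => ?_
  subst hb
  obtain ⟨rfl, rfl⟩ := h.calls₃_eq_zero hP
  linarith [h.le_calls₃ hP]

theorem FirstOrder.calls₃_eq (h : FirstOrder P a₁ b₁ c₁ d₁ a₂ b₂ c₂ d₂ b₃ c₃ d₃) (hP : 2 ≤ P)
    (hb : 0 < b₃) : (P + 1) * (c₁ + d₂) = 2 * P - 4 + 2 * a₁ + 2 * a₂ := by
  linarith [h.B₃.gain_eq_zero hb (h.b₃_lt_one hP)]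

theorem FirstOrder.calls₂_eq (h : FirstOrder P a₁ b₁ c₁ d₁ a₂ b₂ c₂ d₂ b₃ c₃ d₃) (hP : 2 ≤ P)
    (hb : 0 < b₂) : (P + 1) * (c₃ + d₁) = 2 * P - 4 + 2 * a₁ := by
  linarith [h.B₂.gain_eq_zero hb (h.b₂_lt_one hP)]

theorem FirstOrder.calls₁_eq (h : FirstOrder P a₁ b₁ c₁ d₁ a₂ b₂ c₂ d₂ b₃ c₃ d₃) (hP : 2 ≤ P)
    (hb : 0 < b₁) : (P + 1) * (c₂ + d₃) = 2 * P - 4 := by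
  linarith [h.B₁.gain_eq_zero hb (h.b₁_lt_one hP)]

/-- If Player 2 never bets with `A`, she never bets with `Q`. -/
theorem FirstOrder.b₂_eq_zero (h : FirstOrder P a₁ b₁ c₁ d₁ 0 b₂ c₂ d₂ b₃ c₃ d₃)
    (hP : 2 ≤ P) : b₂ = 0 := by
  by_contra hne
  have hb : 0 < b₂ := lt_of_le_of_ne h.hb₂.1 (Ne.symm hne)
  have hd := h.D₁.eq_one h.hd₁.2 (by nlinarith)
  have hc := h.C₃.eq_one h.hc₃.2 (by nlinarith [mul_nonneg h.ha₁.1 hb.le])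
  have := h.B₂.2 hb
  subst hd hc
  linarith [h.ha₁.2]

/-! ### Equilibria in which Player 1 never bets. -/

theorem FirstOrder.mem_of_a₁_a₂_eq_zero (h : FirstOrder P 0 0 c₁ d₁ 0 0 c₂ d₂ b₃ c₃ d₃)
    (hP : 2 ≤ P) :
    (P = 2 ∧ Profile.mk 0 0 c₁ d₁ 0 0 c₂ d₂ b₃ c₃ d₃ ∈ solution1a) ∨
      (P ≤ 3 ∧ Profile.mk 0 0 c₁ d₁ 0 0 c₂ d₂ b₃ c₃ d₃ ∈ solution1 P) := by
  have hx := h.le_calls₁ hP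
  have hy := h.le_calls₂ hP
  have hA₁ := h.A₁.1 one_pos
  have hA₂ := h.A₂.1 one_pos
  obtain ⟨hc₁0, hc₁1⟩ := h.hc₁
  obtain ⟨hd₂0, hd₂1⟩ := h.hd₂
  obtain ⟨hb₃0, hb₃1⟩ := h.hb₃
  rcases hP.eq_or_lt with rfl | hP2
  · left
    have hzero : c₁ = 0 ∧ d₂ = 0 := by
      rcases hb₃0.eq_or_lt with rfl | hb
      · exact h.calls₃_eq_zero le_rfl
      · have := h.calls₃_eq le_rfl hb
        constructor <;> linarith
    obtain ⟨rfl, rfl⟩ := hzero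
    have hD := h.D₂.1 one_pos
    exact ⟨rfl, h.feasible, rfl, rfl, rfl, rfl, hb₃0, by dsimp; linarith, rfl, rfl,
      by dsimp; linarith, by dsimp; linarith⟩
  · right
    have hb := h.b₃_pos hP (by linarith)
    have hz := h.calls₃_eq hP hb
    have hlt : 0 + (P + 0) * b₃ - 2 < 0 + (P + 1) * b₃ - 2 := by linarith
    have hB : 0 < P + 1 := by linarith
    by_cases hz1 : c₁ + d₂ < 1
    · obtain rfl := h.C₁.left_eq_zero h.D₂ hlt hc₁0 hd₂1 hz1
      have hd : 0 < d₂ := by nlinarith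
      have hD := h.D₂.gain_eq_zero hd (by linarith)
      have hb₃ : b₃ = 2 / (P + 1) := by rw [eq_div_iff hB.ne']; linarith
      have hP3 : P ≤ 3 := by nlinarith
      have e : 2 / (P + 1) = b₃ := hb₃.symm
      refine ⟨hP3, h.feasible, rfl, rfl, rfl, rfl, hb₃, rfl, ?_, ?_, ?_, ?_, ?_⟩ <;> dsimp
      · rw [eq_div_iff hB.ne']; linarith
      · rw [div_le_iff₀ hB]; linarith
      · linarith
      · rw [div_le_iff₀ hB]; linarith
      · linarith
    -- A total of at least 1 would need `P ≥ 5`; then `c₁ < 1` gives `P * b₃ ≤ 2`, so Player 3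
    -- bluffs too rarely to keep Player 2 from betting `A`.
    · push Not at hz1
      exfalso
      obtain rfl := h.C₁.right_eq_one h.D₂ hlt hc₁0 hd₂1 hz1
      have hP5 : 5 ≤ P := by nlinarith
      have hC := h.C₁.1 (by nlinarith)
      have : b₃ * c₁ ≤ b₃ := by nlinarith
      nlinarith

/-- Without bluffs by Player 2 no `K` calls her, so betting `A` only forgoes what a check earns from
the bluffs of Player 3. -/
theorem FirstOrder.b₂_pos_of_a₁_eq_zero (h : FirstOrder P 0 0 c₁ d₁ a₂ b₂ c₂ d₂ b₃ c₃ d₃)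
    (hP : 2 ≤ P) (ha : 0 < a₂) : 0 < b₂ := by
  refine lt_of_le_of_ne h.hb₂.1 fun hb => ?_
  subst hb
  obtain rfl := h.D₁.eq_zero h.hd₁.1 (by linarith)
  obtain rfl := h.C₃.eq_zero h.hc₃.1 (by linarith)
  have := h.A₂.2 ha
  have := h.b₃_pos hP (by linarith)
  nlinarith [h.hc₁.1]

theorem FirstOrder.two_lt_of_a₁_eq_zero (h : FirstOrder P 0 0 c₁ d₁ a₂ b₂ c₂ d₂ b₃ c₃ d₃)
    (hP : 2 ≤ P) (ha : 0 < a₂) : 2 < P := by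
  refine lt_of_le_of_ne hP fun hP2 => ?_
  subst hP2
  have hb := h.b₂_pos_of_a₁_eq_zero hP ha
  have := h.calls₂_eq hP hb
  have := h.A₂.2 ha
  have := h.b₃_pos hP (by linarith)
  nlinarith [h.hc₁.1]

/-- For `P ≥ 5` the calls against Player 2 give `P * b₂ ≤ 2`. Since Player 1 prefers checking `A`,
the later bluffs must be frequent, whence `P * b₃ ≥ 2`. Both opponents then always call Player 3,
more than her indifference allows. -/
theorem FirstOrder.lt_five_of_a₁_eq_zero (h : FirstOrder P 0 0 c₁ d₁ a₂ b₂ c₂ d₂ b₃ c₃ d₃)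
    (ha : 0 < a₂) : P < 5 := by
  by_contra! hP5
  have hP : 2 ≤ P := by linarith
  have hb₂ := h.b₂_pos_of_a₁_eq_zero hP ha
  have hy := h.calls₂_eq hP hb₂
  have hx := h.le_calls₁ hP
  have hb₃ := h.b₃_pos hP (by linarith)
  have hz := h.calls₃_eq hP hb₃
  have hA₁ := h.A₁.1 one_pos
  have ha1 := h.ha₂.2
  obtain ⟨hc₃0, hc₃1⟩ := h.hc₃
  obtain rfl := h.C₃.right_eq_one h.D₁ (by linarith) hc₃0 h.hd₁.2 (by nlinarith)
  have hC₃ := h.C₃.1 (by nlinarith)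
  have hPb₂ : P * b₂ ≤ 2 := by linarith
  have hbc : b₂ * c₃ ≤ b₂ := by nlinarith
  have hPb₃ : 2 ≤ P * b₃ := by
    have h1 : 2 * P - 4 ≤ (P + 1) * (3 / 2 * b₂ + b₃) := by nlinarith
    have h2 : P * (2 * P - 4) ≤ (P + 1) * (3 / 2 * (P * b₂) + P * b₃) := by nlinarith
    nlinarith
  have := mul_pos ha hb₃
  obtain rfl := h.D₂.eq_one h.hd₂.2 (by linarith)
  obtain rfl := h.C₁.eq_one h.hc₁.2 (by linarith)
  linarith

theorem FirstOrder.responses_of_a₁_eq_zero (h : FirstOrder P 0 0 c₁ d₁ a₂ b₂ c₂ d₂ b₃ c₃ d₃)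
    (hP : 2 ≤ P) (ha : 0 < a₂) :
    c₃ = 0 ∧ (P + 1) * d₁ = 2 * P - 4 ∧ (P + 1) * b₂ = 2 * a₂ := by
  have hP5 := h.lt_five_of_a₁_eq_zero ha
  have hP2 := h.two_lt_of_a₁_eq_zero hP ha
  have hb₂ := h.b₂_pos_of_a₁_eq_zero hP ha
  have hy := h.calls₂_eq hP hb₂
  obtain rfl := h.C₃.left_eq_zero h.D₁ (by linarith) h.hc₃.1 h.hd₁.2 (by nlinarith)
  have := h.D₁.gain_eq_zero (by nlinarith) (by nlinarith)
  exact ⟨rfl, by linarith, by linarith⟩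

theorem FirstOrder.mem_solution5 (h : FirstOrder P 0 0 c₁ d₁ 1 b₂ c₂ d₂ b₃ c₃ d₃)
    (hP : 2 ≤ P) : 7 / 2 ≤ P ∧ P ≤ 4 ∧
      Profile.mk 0 0 c₁ d₁ 1 b₂ c₂ d₂ b₃ c₃ d₃ ∈ solution5 P := by
  have hP2 := h.two_lt_of_a₁_eq_zero hP one_pos
  obtain ⟨rfl, hd₁, hb₂⟩ := h.responses_of_a₁_eq_zero hP one_pos
  have hx := h.le_calls₁ hP
  have hb₃ := h.b₃_pos hP (by linarith)
  have hz := h.calls₃_eq hP hb₃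
  have hA₁ := h.A₁.1 one_pos
  have hA₂ := h.A₂.2 one_pos
  have hb₂0 := h.b₂_pos_of_a₁_eq_zero hP one_pos
  obtain ⟨hc₁0, hc₁1⟩ := h.hc₁
  obtain ⟨hd₂0, hd₂1⟩ := h.hd₂
  have hB : 0 < P + 1 := by linarith
  rcases lt_trichotomy ((P + 1) * b₃) 2 with hlt | heq | hgt
  · exfalso
    obtain rfl := h.D₂.eq_zero hd₂0 (by linarith)
    have hP3 : P ≤ 3 := by nlinarith
    have hC := h.C₁.2 (by nlinarith)
    have h1 : 2 * P ≤ (P + 1) * ((P + 1) * b₃) := by nlinarith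
    have h2 : (P + 1) * ((P + 1) * (2 * d₁)) ≥ (P + 1) * ((P + 1) * b₃) * (2 + c₁) := by nlinarith
    have h3 : 2 * P * (2 + c₁) ≤ (P + 1) * (4 * P - 8) := by nlinarith
    -- The total `c₁ + 0` gives `(P + 1) * (2 + c₁) = 4P`. The resulting inequality fails for `2 < P
    -- ≤ 3`.
    have h4 : 2 * P * (4 * P) ≤ (P + 1) * ((P + 1) * (4 * P - 8)) := by nlinarith
    nlinarith [mul_pos (sub_pos.2 hP2) (sub_pos.2 hP2)]
  · obtain rfl := h.C₁.eq_one hc₁1 (by linarith)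
    have hP7 : 7 / 2 ≤ P := by nlinarith
    have hP4 : P ≤ 4 := by nlinarith
    have e4 : 4 / (P + 1) = b₂ + b₃ := by rw [div_eq_iff hB.ne']; linarith
    refine ⟨hP7, hP4, h.feasible, rfl, rfl, rfl, ?_, ?_, rfl, ?_, rfl, ?_, ?_, ?_⟩ <;> dsimp
    · rw [eq_div_iff hB.ne']; linarith
    · rw [eq_div_iff hB.ne']; linarith
    · rw [eq_div_iff hB.ne']; linarith
    · rw [eq_div_iff hB.ne']; linarith
    · rw [div_le_iff₀ hB]; linarith
    · rw [e4]; linarith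
  · exfalso
    obtain rfl := h.D₂.eq_one hd₂1 (by linarith)
    obtain rfl := h.C₁.eq_one hc₁1 (by linarith)
    linarith

/-! ### The thresholds as quadratic inequalities. -/

theorem root_le_iff {r s t x : ℝ} (ht : 0 < t) (hr : r ≤ t * x) :
    (r + √s) / t ≤ x ↔ s ≤ (t * x - r) ^ 2 := by
  rw [div_le_iff₀ ht, ← le_sub_iff_add_le', mul_comm, Real.sqrt_le_iff]
  exact and_iff_right (by linarith)

theorem le_root_iff {r s t x : ℝ} (ht : 0 < t) (hs : 0 ≤ s) (hr : r ≤ t * x) :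
    x ≤ (r + √s) / t ↔ (t * x - r) ^ 2 ≤ s := by
  rw [le_div_iff₀ ht, ← sub_le_iff_le_add', mul_comm, Real.le_sqrt (by linarith) hs]

theorem P₃_le_iff (hP : 2 ≤ P) : P₃ ≤ P ↔ 3 * P + 11 ≤ 2 * P ^ 2 := by
  rw [P₃, root_le_iff (by norm_num) (by linarith)]
  constructor <;> intro h <;> nlinarith

theorem le_P₃_iff (hP : 2 ≤ P) : P ≤ P₃ ↔ 2 * P ^ 2 ≤ 3 * P + 11 := by
  rw [P₃, le_root_iff (by norm_num) (by norm_num) (by linarith)]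
  constructor <;> intro h <;> nlinarith

theorem P₄_le_iff (hP : 2 ≤ P) : P₄ ≤ P ↔ 6 * P + 3 ≤ 2 * P ^ 2 := by
  rw [P₄, root_le_iff (by norm_num) (by linarith)]
  constructor <;> intro h <;> nlinarith

theorem le_P₄_iff (hP : 2 ≤ P) : P ≤ P₄ ↔ 2 * P ^ 2 ≤ 6 * P + 3 := by
  rw [P₄, le_root_iff (by norm_num) (by norm_num) (by linarith)]
  constructor <;> intro h <;> nlinarith

theorem P₆_le_iff (hP : 2 ≤ P) : P₆ ≤ P ↔ 6 * P + 7 ≤ 2 * P ^ 2 := by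
  rw [P₆, root_le_iff (by norm_num) (by linarith)]
  constructor <;> intro h <;> nlinarith

theorem le_P₆_iff (hP : 2 ≤ P) : P ≤ P₆ ↔ 2 * P ^ 2 ≤ 6 * P + 7 := by
  rw [P₆, le_root_iff (by norm_num) (by norm_num) (by linarith)]
  constructor <;> intro h <;> nlinarith

theorem P₈_le_iff (hP : 2 ≤ P) : P₈ ≤ P ↔ 7 * P + 7 ≤ 2 * P ^ 2 := by
  rw [P₈, root_le_iff (by norm_num) (by linarith)]
  constructor <;> intro h <;> nlinarith

theorem le_P₈_iff (hP : 2 ≤ P) : P ≤ P₈ ↔ 2 * P ^ 2 ≤ 7 * P + 7 := by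
  rw [P₈, le_root_iff (by norm_num) (by norm_num) (by linarith)]
  constructor <;> intro h <;> nlinarith

theorem P₉_le_iff (hP : 2 ≤ P) : P₉ ≤ P ↔ 7 * P + 8 ≤ 2 * P ^ 2 := by
  rw [P₉, root_le_iff (by norm_num) (by linarith)]
  constructor <;> intro h <;> nlinarith

theorem le_P₉_iff (hP : 2 ≤ P) : P ≤ P₉ ↔ 2 * P ^ 2 ≤ 7 * P + 8 := by
  rw [P₉, le_root_iff (by norm_num) (by norm_num) (by linarith)]
  constructor <;> intro h <;> nlinarith

/-! ### Player 1 never bets and Player 2 mixes with her ace. -/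

theorem FirstOrder.mem_of_c₁_eq_zero (h : FirstOrder P 0 0 0 d₁ a₂ b₂ c₂ d₂ b₃ 0 d₃)
    (hP : 2 < P) (ha0 : 0 < a₂) (ha1 : a₂ < 1)
    (hd₁ : (P + 1) * d₁ = 2 * P - 4) (hb₂ : (P + 1) * b₂ = 2 * a₂) (hb₃ : 0 < b₃) :
    P = 3 ∧ Profile.mk 0 0 0 d₁ a₂ b₂ c₂ d₂ b₃ 0 d₃ ∈ solution2a := by
  have hx := h.le_calls₁ hP.le
  have hz := h.calls₃_eq hP.le hb₃
  have hA₁ := h.A₁.1 one_pos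
  have hA₂ := h.A₂.gain_eq_zero ha0 ha1
  obtain rfl : b₃ = d₁ := by linarith
  have hC := h.C₁.1 one_pos
  obtain ⟨hd₂0, hd₂1⟩ := h.hd₂
  have hD := h.D₂.2 (by nlinarith)
  rcases hd₂1.lt_or_eq with hd | rfl
  · have hD' := h.D₂.1 hd
    obtain rfl : P = 3 := by linarith
    obtain rfl : b₃ = 1 / 2 := by linarith
    refine ⟨rfl, h.feasible, rfl, rfl, ?_, ?_, ?_, rfl, ?_, rfl, ?_, ?_, ?_⟩ <;>
      (try dsimp) <;> linarith
  -- With `2 * a₂ = 5 - P` the nonpositive gain of `c₁` reads `P ^ 2 ≤ 7`, while `hD` gives `P ≥ 3`.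
  · exfalso
    have ha : 2 * a₂ = 5 - P := by linarith
    have h1 : (P + 1) * ((P + a₂) * b₃) = (P + a₂) * (2 * P - 4) := by rw [← hd₁]; ring
    nlinarith

theorem FirstOrder.mem_of_c₁_eq_one (h : FirstOrder P 0 0 1 d₁ a₂ b₂ c₂ d₂ b₃ 0 d₃)
    (hP : 2 < P) (ha0 : 0 < a₂) (ha1 : a₂ < 1)
    (hd₁ : (P + 1) * d₁ = 2 * P - 4) (hb₂ : (P + 1) * b₂ = 2 * a₂) (hb₃ : 0 < b₃) :
    (P ∈ Set.Icc P₃ (7 / 2) ∧ Profile.mk 0 0 1 d₁ a₂ b₂ c₂ d₂ b₃ 0 d₃ ∈ solution4 P) ∨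
    (P = 7 / 2 ∧ Profile.mk 0 0 1 d₁ a₂ b₂ c₂ d₂ b₃ 0 d₃ ∈ solution5a) := by
  have hx := h.le_calls₁ hP.le
  have hz := h.calls₃_eq hP.le hb₃
  have hA₁ := h.A₁.1 one_pos
  have hA₂ := h.A₂.gain_eq_zero ha0 ha1
  have hb₃' : 3 * b₃ = 2 * d₁ := by linarith
  have hBb₃ : (P + 1) * b₃ = (4 * P - 8) / 3 := by
    linear_combination (P + 1) / 3 * hb₃' + 2 / 3 * hd₁
  have hC := h.C₁.2 one_pos
  obtain ⟨hd₂0, hd₂1⟩ := h.hd₂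
  have hB : 0 < P + 1 := by linarith
  have hD := h.D₂.1 (by nlinarith)
  have hP7 : P ≤ 7 / 2 := by linarith
  -- The gain of `d₂` is a positive multiple of `P - 7/2` plus nothing else, up to the factor `P +
  -- 1`. At equality `d₂` is undetermined, which frees `a₂`.
  rcases hP7.lt_or_eq with hlt | rfl
  · left
    obtain rfl := h.D₂.eq_zero hd₂0 (by linarith)
    have ha : 2 * a₂ = 5 - P := by linarith
    have h1 : (P + 1) * ((P + a₂) * b₃) = (P + a₂) * ((4 * P - 8) / 3) := by
      linear_combination (P + a₂) * ((P + 1) / 3 * hb₃' + 2 / 3 * hd₁)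
    have hb₃e : b₃ = 4 * (P - 2) / (3 * (P + 1)) := by
      rw [eq_div_iff (by linarith)]; linarith
    have hsum : (P + 7) / (3 * (P + 1)) = b₂ + b₃ := by
      rw [div_eq_iff (by linarith)]; linarith
    refine ⟨⟨(P₃_le_iff hP.le).2 ?_, hP7⟩, h.feasible, rfl, rfl, ?_, ?_, hb₃e, rfl, rfl, rfl, ?_,
      ?_, ?_⟩ <;> try dsimp
    · have h2 : 0 ≤ 2 * a₂ + (P + a₂) * ((4 * P - 8) / 3) - 2 * (P + 1) := by
        rw [← h1, ← hb₂]; nlinarith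
      nlinarith
    · linarith
    · rw [eq_div_iff hB.ne']; linarith
    · rw [eq_div_iff hB.ne']; linarith
    · rw [div_le_iff₀ hB]; linarith
    · rw [hsum]; linarith
  · right
    refine ⟨rfl, h.feasible, rfl, rfl, ?_, ?_, ?_, rfl, ?_, rfl, ?_, ?_, ?_⟩ <;>
      (try dsimp) <;> linarith

/-- The equation satisfied by `a₂` in the third family, in terms of the larger root. -/
theorem eq_root_of_quadratic {a : ℝ} (hP : 2 ≤ P) (ha : 0 ≤ a)
    (h : a ^ 2 + (P ^ 2 - 4) * a + (P + 1) * (P ^ 2 - 4 * P + 1) = 0) :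
    a = (1 / 2) * (4 - P ^ 2 + √(P ^ 4 - 4 * P ^ 3 + 4 * P ^ 2 + 12 * P + 12)) := by
  have : P ^ 4 - 4 * P ^ 3 + 4 * P ^ 2 + 12 * P + 12 = (2 * a + P ^ 2 - 4) ^ 2 := by
    linear_combination (-4) * h
  rw [this, Real.sqrt_sq (by nlinarith)]
  ring

theorem FirstOrder.mem_of_c₁_mem_Ioo (h : FirstOrder P 0 0 c₁ d₁ a₂ b₂ c₂ d₂ b₃ 0 d₃)
    (hP : 2 < P) (ha0 : 0 < a₂) (ha1 : a₂ < 1) (hc0 : 0 < c₁) (hc1 : c₁ < 1)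
    (hd₁ : (P + 1) * d₁ = 2 * P - 4) (hb₂ : (P + 1) * b₂ = 2 * a₂) (hb₃ : 0 < b₃) :
    (P ∈ Set.Icc 3 P₄ ∧ Profile.mk 0 0 c₁ d₁ a₂ b₂ c₂ d₂ b₃ 0 d₃ ∈ solution2 P) ∨
    (P ∈ Set.Icc P₃ P₄ ∧ Profile.mk 0 0 c₁ d₁ a₂ b₂ c₂ d₂ b₃ 0 d₃ ∈ solution3 P) := by
  have hx := h.le_calls₁ hP.le
  have hz := h.calls₃_eq hP.le hb₃
  have hA₁ := h.A₁.1 one_pos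
  have hA₂ := h.A₂.gain_eq_zero ha0 ha1
  have hC := h.C₁.gain_eq_zero hc0 hc1
  obtain ⟨hd₂0, hd₂1⟩ := h.hd₂
  have hB : 0 < P + 1 := by linarith
  have hbc : b₃ * (2 + c₁) = 2 * d₁ := by linarith
  have e1 : (P + 1) * ((P + a₂) * b₃) = 2 * (P + 1) - 2 * a₂ := by
    linear_combination (P + 1) * hC - hb₂
  rcases hd₂0.eq_or_lt with rfl | hd0
  · right
    have hD := h.D₂.1 one_pos
    have e2 : (P + 1) * (2 + c₁) = 4 * P - 2 + 2 * a₂ := by linarith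
    -- Indifference of `c₁` and of `a₂` are two equations for `b₃`; eliminating `b₃` and `c₁` leaves
    -- this quadratic.
    have e3 : a₂ ^ 2 + (P ^ 2 - 4) * a₂ + (P + 1) * (P ^ 2 - 4 * P + 1) = 0 := by
      have : (2 * (P + 1) - 2 * a₂) * (4 * P - 2 + 2 * a₂) =
          (P + a₂) * (P + 1) * (2 * (2 * P - 4)) := by
        rw [← e1, ← e2, ← hd₁]
        linear_combination (P + a₂) * (P + 1) ^ 2 * hbc
      linear_combination (-1 / 4) * this
    have ha : 1 / 2 ≤ a₂ := by nlinarith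
    have ha' : 2 * a₂ ≤ 5 - P := by nlinarith
    refine ⟨⟨(P₃_le_iff hP.le).2 ?_, (le_P₄_iff hP.le).2 ?_⟩, h.feasible, rfl, rfl,
      eq_root_of_quadratic hP.le ha0.le e3, ?_, ?_, ?_, rfl, rfl, ?_, ?_, ?_⟩ <;> try dsimp
    -- The product is the difference of the values of the quadratic at `(5 - P) / 2` and at its root
    -- `a₂`. The other threshold comes from comparing with `1 / 2` in the same way.
    · have h1 : 0 ≤ ((5 - P) / 2 - a₂) * ((5 - P) / 2 + a₂ + P ^ 2 - 4) :=
        mul_nonneg (by linarith) (by nlinarith)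
      have h2 : 0 ≤ (P + 1) * (2 * P ^ 2 - 3 * P - 11) := by nlinarith
      linarith [nonneg_of_mul_nonneg_right h2 hB]
    · have h1 : 0 ≤ (a₂ - 1 / 2) * (a₂ + 1 / 2 + P ^ 2 - 4) :=
        mul_nonneg (by linarith) (by nlinarith)
      have h2 : 0 ≤ (2 * P + 1) * (3 + 6 * P - 2 * P ^ 2) := by nlinarith
      linarith [nonneg_of_mul_nonneg_right h2 (by linarith)]
    · rw [eq_div_iff hB.ne']; linarith
    · rw [eq_div_iff (by linarith)]; linarith
    · rw [eq_div_iff hB.ne']; linarith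
    · rw [eq_div_iff hB.ne']; linarith
    · rw [div_le_iff₀ hB]; linarith
    · linarith
  · left
    have hD := h.D₂.2 hd0
    rcases hd₂1.lt_or_eq with hd1 | rfl
    · have hD' := h.D₂.1 hd1
      have hb₃' : (P + 1) * b₃ = 2 := by linarith
      obtain rfl : a₂ = 1 / 2 := by nlinarith
      have hc : c₁ = 2 * P - 6 := by
        have : (P + 1) * b₃ * (2 + c₁) = 2 * (2 * P - 4) := by
          rw [← hd₁]; linear_combination (P + 1) * hbc
        rw [hb₃'] at this
        linarith
      have e3 : 3 / (P + 1) = b₂ + b₃ := by rw [div_eq_iff hB.ne']; linarith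
      have hd₂ : (P + 1) * d₂ = 3 + 6 * P - 2 * P ^ 2 := by rw [hc] at hz; linarith
      refine ⟨⟨by linarith, (le_P₄_iff hP.le).2 ?_⟩, h.feasible, rfl, rfl, rfl, ?_, ?_, hc, ?_, rfl,
        ?_, ?_, ?_⟩ <;> try dsimp
      · nlinarith
      · rw [eq_div_iff hB.ne']; linarith
      · rw [eq_div_iff hB.ne']; linarith
      · rw [eq_div_iff hB.ne']; linarith
      · rw [eq_div_iff hB.ne']; linarith
      · rw [div_le_iff₀ hB]; linarith
      · rw [e3]; linarith
    -- Here `d₂ = 1` and `c₁ > 0` push `P` above 4, where bluffs as rare as `a₂ ≤ 1/2` and `P * b₃ ≤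
    -- 2` imply would make Player 1 bet her ace.
    · exfalso
      have ha : a₂ ≤ 1 / 2 := by nlinarith
      have hP4 : 4 < P := by nlinarith
      have h1 : P * b₃ ≤ 2 := by nlinarith
      have h2 : 2 * P - 4 ≤ (P + 1) * (b₂ + b₃) := by nlinarith
      nlinarith

/-- `σ` belongs to a solution family valid at `P` or to the special set at `P`. -/
def IsListed (P : ℝ) (σ : Profile) : Prop :=
  (∃ k : Label, P ∈ validRange k ∧ σ ∈ family k P) ∨ (P = 2 ∧ σ ∈ solution1a) ∨
    (P = 3 ∧ σ ∈ solution2a) ∨ (P = 7 / 2 ∧ σ ∈ solution5a) ∨ (P = 5 ∧ σ ∈ solution10a)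

theorem FirstOrder.isListed_of_a₁_eq_zero (h : FirstOrder P 0 b₁ c₁ d₁ a₂ b₂ c₂ d₂ b₃ c₃ d₃)
    (hP : 2 ≤ P) : IsListed P (Profile.mk 0 b₁ c₁ d₁ a₂ b₂ c₂ d₂ b₃ c₃ d₃) := by
  obtain rfl := h.b₁_eq_zero hP
  rcases h.ha₂.1.eq_or_lt with rfl | ha0
  · obtain rfl := h.b₂_eq_zero hP
    rcases h.mem_of_a₁_a₂_eq_zero hP with hm | ⟨hP3, hm⟩
    · exact Or.inr (Or.inl hm)
    · exact Or.inl ⟨.s1, ⟨hP, hP3⟩, hm⟩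
  rcases h.ha₂.2.eq_or_lt with rfl | ha1
  · obtain ⟨hP7, hP4, hm⟩ := h.mem_solution5 hP
    exact Or.inl ⟨.s5, ⟨hP7, hP4⟩, hm⟩
  have hP2 := h.two_lt_of_a₁_eq_zero hP ha0
  obtain ⟨rfl, hd₁, hb₂⟩ := h.responses_of_a₁_eq_zero hP ha0
  have hb₃ := h.b₃_pos hP (by linarith)
  rcases h.hc₁.1.eq_or_lt with rfl | hc0
  · exact Or.inr (Or.inr (Or.inl (h.mem_of_c₁_eq_zero hP2 ha0 ha1 hd₁ hb₂ hb₃)))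
  rcases h.hc₁.2.eq_or_lt with rfl | hc1
  · rcases h.mem_of_c₁_eq_one hP2 ha0 ha1 hd₁ hb₂ hb₃ with hm | hm
    · exact Or.inl ⟨.s4, hm⟩
    · exact Or.inr (Or.inr (Or.inr (Or.inl hm)))
  · rcases h.mem_of_c₁_mem_Ioo hP2 ha0 ha1 hc0 hc1 hd₁ hb₂ hb₃ with hm | hm
    · exact Or.inl ⟨.s2, hm⟩
    · exact Or.inl ⟨.s3, hm⟩

/-! ### Equilibria in which Player 1 bets: bounds, and Player 2 always bets her ace. -/

theorem FirstOrder.b₁_pos (h : FirstOrder P a₁ b₁ c₁ d₁ a₂ b₂ c₂ d₂ b₃ c₃ d₃) (hP : 2 ≤ P)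
    (ha : 0 < a₁) : 0 < b₁ := by
  refine lt_of_le_of_ne h.hb₁.1 fun hb => ?_
  subst hb
  obtain rfl := h.D₃.eq_zero h.hd₃.1 (by linarith)
  obtain rfl := h.C₂.eq_zero h.hc₂.1 (by linarith)
  have := h.A₁.2 ha
  have := h.b₃_pos hP (by linarith [h.ha₂.1])
  nlinarith [mul_nonneg h.hb₂.1 h.hc₃.1, h.hb₂.1]

theorem FirstOrder.two_lt_of_a₁_pos (h : FirstOrder P a₁ b₁ c₁ d₁ a₂ b₂ c₂ d₂ b₃ c₃ d₃)
    (hP : 2 ≤ P) (ha : 0 < a₁) : 2 < P := by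
  have hx := h.calls₁_eq hP (h.b₁_pos hP ha)
  have := h.A₁.2 ha
  have := h.b₃_pos hP (by linarith [h.ha₂.1])
  nlinarith [mul_nonneg h.hb₂.1 h.hc₃.1, h.hb₂.1]

/-- `P = 5` is where the total `(2P - 4) / (P + 1)` of calls against Player 1 reaches 1, so that
`c₂` can come into play. -/
theorem FirstOrder.responses₁_of_lt_five (h : FirstOrder P a₁ b₁ c₁ d₁ a₂ b₂ c₂ d₂ b₃ c₃ d₃)
    (hP : 2 ≤ P) (ha : 0 < a₁) (hP5 : P < 5) :
    c₂ = 0 ∧ (P + 1) * d₃ = 2 * P - 4 ∧ (P + 1) * b₁ = 2 * a₁ := by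
  have hb := h.b₁_pos hP ha
  have hx := h.calls₁_eq hP hb
  have hP2 := h.two_lt_of_a₁_pos hP ha
  obtain rfl := h.C₂.left_eq_zero h.D₃ (by linarith) h.hc₂.1 h.hd₃.2 (by nlinarith)
  have := h.D₃.gain_eq_zero (by nlinarith) (by nlinarith)
  exact ⟨rfl, by linarith, by linarith⟩

theorem FirstOrder.responses₁_of_five_le (h : FirstOrder P a₁ b₁ c₁ d₁ a₂ b₂ c₂ d₂ b₃ c₃ d₃)
    (ha : 0 < a₁) (hP5 : 5 ≤ P) :
    d₃ = 1 ∧ (P + 1) * c₂ = P - 5 ∧ 2 * a₁ ≤ (P + 1) * b₁ ∧ P * b₁ ≤ 2 * a₁ := by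
  have hP : 2 ≤ P := by linarith
  have hb := h.b₁_pos hP ha
  have hx := h.calls₁_eq hP hb
  obtain rfl := h.C₂.right_eq_one h.D₃ (by linarith) h.hc₂.1 h.hd₃.2 (by nlinarith)
  have := h.C₂.1 (by nlinarith)
  have := h.D₃.2 one_pos
  exact ⟨rfl, by linarith, by linarith, by linarith⟩

theorem FirstOrder.b₁_bounds (h : FirstOrder P a₁ b₁ c₁ d₁ a₂ b₂ c₂ d₂ b₃ c₃ d₃)
    (hP : 2 ≤ P) (ha : 0 < a₁) :
    2 * a₁ ≤ (P + 1) * b₁ ∧ (P + 1) * b₁ ≤ 3 * a₁ ∧ b₁ ≤ a₁ := by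
  have hb := h.b₁_pos hP ha
  rcases lt_or_ge P 5 with hP5 | hP5
  · obtain ⟨-, -, hb₁⟩ := h.responses₁_of_lt_five hP ha hP5
    exact ⟨by linarith, by linarith, by nlinarith⟩
  · obtain ⟨-, -, h1, h2⟩ := h.responses₁_of_five_le ha hP5
    exact ⟨h1, by nlinarith, by nlinarith⟩

/-- Scaled by `P + 1`, the calls against Player 2 exceed those against Player 1 by at least `2 *
a₁`, yet an ace bet would pay for Player 1 and not for Player 2. If `c₁ = 0`, the bound `(P + 1) *
b₁ ≤ 3 * a₁` refutes this; if `d₂ = 1`, the bound `P * b₃ ≤ 2` does. -/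
theorem FirstOrder.a₂_pos (h : FirstOrder P a₁ b₁ c₁ d₁ a₂ b₂ c₂ d₂ b₃ c₃ d₃)
    (hP : 2 ≤ P) (ha : 0 < a₁) : 0 < a₂ := by
  refine lt_of_le_of_ne h.ha₂.1 fun h0 => ?_
  subst h0
  obtain rfl := h.b₂_eq_zero hP
  have hP2 := h.two_lt_of_a₁_pos hP ha
  have hb₁ := h.b₁_pos hP ha
  have hx := h.calls₁_eq hP hb₁
  have hy := h.le_calls₂ hP
  have hb₃ := h.b₃_pos hP (by linarith)
  have hz := h.calls₃_eq hP hb₃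
  have hA₁ := h.A₁.2 ha
  have hA₂ := h.A₂.1 one_pos
  obtain ⟨hlo, hhi, hle⟩ := h.b₁_bounds hP ha
  obtain ⟨hc₁0, hc₁1⟩ := h.hc₁
  obtain ⟨hc₃0, hc₃1⟩ := h.hc₃
  have ha1 := h.ha₁.2
  have hB : 0 < P + 1 := by linarith
  have hbc : b₁ * c₃ ≤ b₁ := by nlinarith
  have hlt : 0 + (P + 0) * b₃ - 2 < b₁ + (P + 1) * b₃ - 2 := by linarith
  by_cases hz1 : c₁ + d₂ < 1
  · obtain rfl := h.C₁.left_eq_zero h.D₂ hlt hc₁0 h.hd₂.2 hz1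
    nlinarith
  · push Not at hz1
    obtain rfl := h.C₁.right_eq_one h.D₂ hlt hc₁0 h.hd₂.2 hz1
    have hP3 : 3 ≤ P := by nlinarith
    have hC := h.C₁.1 (by nlinarith)
    have hBc : (P + 1) * (2 + c₁) = 3 * P - 3 + 2 * a₁ := by linarith
    have h1 : 4 * P - 8 + 4 * a₁ ≤ (P + 1) * b₁ + b₃ * (3 * P - 3 + 2 * a₁) := by
      rw [← hBc]; nlinarith
    have h2 : P * b₃ * (3 * P - 3 + 2 * a₁) ≤ 2 * (3 * P - 3 + 2 * a₁) :=
      mul_le_mul_of_nonneg_right (by linarith) (by linarith)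
    have h3 : P * (4 * P - 8 + 4 * a₁ - (P + 1) * b₁) ≤ 2 * (3 * P - 3 + 2 * a₁) := by nlinarith
    rcases lt_or_ge P 5 with hP5 | hP5
    · obtain ⟨-, -, hb⟩ := h.responses₁_of_lt_five hP ha hP5
      rw [hb] at h3
      nlinarith
    · nlinarith

theorem FirstOrder.b₂_pos (h : FirstOrder P a₁ b₁ c₁ d₁ a₂ b₂ c₂ d₂ b₃ c₃ d₃)
    (hP : 2 ≤ P) (ha : 0 < a₁) : 0 < b₂ := by
  refine lt_of_le_of_ne h.hb₂.1 fun h0 => ?_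
  subst h0
  have ha₂ := h.a₂_pos hP ha
  obtain rfl := h.D₁.eq_zero h.hd₁.1 (by linarith)
  obtain rfl := h.C₃.eq_zero h.hc₃.1 (by nlinarith [h.b₁_lt_one hP])
  linarith [h.le_calls₂ hP]

-- Suppose Player 2 is indifferent with `A`. That forces Player 3 to bluff often (`hcall`), while
-- Player 1's willingness to bet limits the sum of the later bluffs (`hsum`). The two cases, by the
-- sign of the gain of `d₂`, show these demands to be incompatible with the calling conditions.
set_option maxHeartbeats 1000000 in
theorem FirstOrder.a₂_eq_one (h : FirstOrder P a₁ b₁ c₁ d₁ a₂ b₂ c₂ d₂ b₃ c₃ d₃)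
    (hP : 2 ≤ P) (ha : 0 < a₁) : a₂ = 1 := by
  by_contra hne
  have ha₂1 : a₂ < 1 := lt_of_le_of_ne h.ha₂.2 hne
  have ha₂ := h.a₂_pos hP ha
  have hP2 := h.two_lt_of_a₁_pos hP ha
  have hb₁ := h.b₁_pos hP ha
  have hb₂ := h.b₂_pos hP ha
  have hb₃ := h.b₃_pos hP (by linarith)
  have hx := h.calls₁_eq hP hb₁
  have hy := h.calls₂_eq hP hb₂
  have hz := h.calls₃_eq hP hb₃
  have hA₁ := h.A₁.2 ha
  have hA₂ := h.A₂.gain_eq_zero ha₂ ha₂1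
  obtain ⟨hlo, hhi, hle⟩ := h.b₁_bounds hP ha
  obtain ⟨hc₁0, hc₁1⟩ := h.hc₁
  obtain ⟨hc₃0, hc₃1⟩ := h.hc₃
  have ha1 := h.ha₁.2
  have hB : 0 < P + 1 := by linarith
  have hbc₁ : (P + 1) * (b₁ * c₃) ≤ (P + 1) * b₁ := by
    apply mul_le_mul_of_nonneg_left _ hB.le
    nlinarith
  have hbc₂ : 0 ≤ (P + 1) * (b₂ * c₃) := by positivity
  have hsum : (P + 1) * b₂ + (P + 1) * b₃ ≤ 2 * P - 4 := by nlinarith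
  have hcall : 4 * P - 8 + 4 * a₁ - (P + 1) * b₁ ≤ (P + 1) * (b₃ * (2 + c₁)) := by nlinarith
  have hBb₂ : 0 < (P + 1) * b₂ := by positivity
  have hc₁pos : 0 < c₁ := by
    by_contra! hc
    obtain rfl : c₁ = 0 := le_antisymm hc hc₁0
    nlinarith
  have hC := h.C₁.2 hc₁pos
  rcases lt_or_ge 0 (b₁ + (P + 1) * b₃ - 2) with hD | hD
  · obtain rfl := h.D₂.eq_one h.hd₂.2 hD
    have hC' := h.C₁.1 (by nlinarith)
    -- Eliminating `b₂` between `hC` and `hsum` leaves `2(P + 1) - (2P - 4) = 6`; with `(P + 1) * b₃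
    -- < 2P - 4` this yields `P > 3`.
    have h6 : 6 ≤ (P + a₂ - 1) * ((P + 1) * b₃) := by nlinarith
    have hP3 : 3 < P := by nlinarith
    have hBc : (P + 1) * (2 + c₁) = 3 * P - 3 + 2 * a₁ + 2 * a₂ := by linarith
    have h1 : (P + a₂) * (4 * P - 8 + 4 * a₁ - (P + 1) * b₁) ≤
        (P + a₂) * (b₃ * (3 * P - 3 + 2 * a₁ + 2 * a₂)) := by
      rw [← hBc]
      apply mul_le_mul_of_nonneg_left _ (by linarith)
      linarith
    have h2 : (P + a₂) * b₃ * (3 * P - 3 + 2 * a₁ + 2 * a₂) ≤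
        2 * (3 * P - 3 + 2 * a₁ + 2 * a₂) :=
      mul_le_mul_of_nonneg_right (by linarith) (by linarith)
    have h3 : (P + a₂) * (4 * P - 8 + 4 * a₁ - (P + 1) * b₁) ≤
        2 * (3 * P - 3 + 2 * a₁ + 2 * a₂) := by linarith
    have haa := mul_pos ha ha₂
    have hq : 0 < (4 * P - 2) * (P - 3) := mul_pos (by linarith) (by linarith)
    have ha₂P : 0 < a₂ * (P - 3) := mul_pos ha₂ (by linarith)
    rcases lt_or_ge P 5 with hP5 | hP5
    · obtain ⟨-, -, hb⟩ := h.responses₁_of_lt_five hP ha hP5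
      rw [hb] at h3
      linarith [mul_pos ha (sub_pos.2 hP2)]
    · have h4 : (P + a₂) * (4 * P - 8 + a₁) ≤ (P + a₂) * (4 * P - 8 + 4 * a₁ - (P + 1) * b₁) :=
        mul_le_mul_of_nonneg_left (by linarith) (by linarith)
      have : 0 < a₁ * (P - 4) := mul_pos ha (by linarith)
      linarith
  · have hbound : (P + 1) * (b₃ * (2 + c₁)) ≤ 3 * (2 - b₁) := by nlinarith
    have hP5 : P < 5 := by linarith
    obtain ⟨-, -, hb⟩ := h.responses₁_of_lt_five hP ha hP5
    have hBb₃ : (P + 1) * (b₃ * (2 + c₁)) ≤ 3 * ((P + 1) * b₃) := by nlinarith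
    -- So few bluffs by Player 2 leave `d₁ = 0`, and all calls against her must come from `c₃`; but
    -- its gain needs `(P + a₁) * b₂ + a₂ * b₁ ≥ 2 * a₂ > 1`, while `b₁ ≤ a₁` keeps the left side
    -- below 1.
    have hBb₂' : (P + 1) * b₂ < 1 - a₁ := by linarith
    have h1 : 2 * (1 - a₂) + (P + a₂) * b₁ ≤ (P + 1) * b₂ := by nlinarith
    have ha₂2 : 1 / 2 < a₂ := by nlinarith
    have hd₁ := h.D₁.eq_zero h.hd₁.1 (by linarith)
    subst hd₁
    have hC₃ := h.C₃.2 (by nlinarith)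
    nlinarith

/-! ### Player 2's bluffing frequency when Player 1 bets. -/

/-- Too few bluffs give `d₁ = 0`, so `c₃` carries all calls and `P ≤ 5 - 2 * a₁`. The calling
conditions on `c₃` and `d₂` bound `b₂` and `b₃` from below so strongly that Player 1 would rather
check her ace. -/
theorem FirstOrder.two_le_mul_b₂ (h : FirstOrder P a₁ b₁ c₁ d₁ 1 b₂ c₂ d₂ b₃ c₃ d₃)
    (hP : 2 ≤ P) (ha : 0 < a₁) : 2 ≤ (P + 1) * b₂ := by
  by_contra! hlt
  have hP2 := h.two_lt_of_a₁_pos hP ha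
  have hb₁ := h.b₁_pos hP ha
  have hb₂ := h.b₂_pos hP ha
  have hb₃ := h.b₃_pos hP (by linarith)
  have hx := h.calls₁_eq hP hb₁
  have hy := h.calls₂_eq hP hb₂
  have hz := h.calls₃_eq hP hb₃
  have hA₁ := h.A₁.2 ha
  have ha1 := h.ha₁.2
  have hB : 0 < P + 1 := by linarith
  obtain rfl := h.D₁.eq_zero h.hd₁.1 (by linarith)
  have hc₃1 := h.hc₃.2
  have hP5 : P ≤ 5 - 2 * a₁ := by nlinarith
  obtain ⟨-, -, hb⟩ := h.responses₁_of_lt_five hP ha (by linarith)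
  have hC₃ := h.C₃.2 (by nlinarith)
  have ha2 : 1 / 2 < a₁ := by
    have : (P + 1) * (2 - b₁) ≤ (P + a₁) * ((P + 1) * b₂) := by nlinarith
    nlinarith
  have hd₂ : 0 < d₂ := by nlinarith [h.hc₁.2]
  have hD := h.D₂.2 hd₂
  have h1 : 2 * P - 4 ≥ (P + 1) * b₂ + (P + 1) * b₃ + b₂ * (P - 2 + a₁) := by
    have : (P + 1) * c₃ = 2 * P - 4 + 2 * a₁ := by linarith
    have h2 : (P + 1) * (b₂ * c₃) = b₂ * (2 * P - 4 + 2 * a₁) := by rw [← this]; ring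
    have h3 : 0 ≤ (P + 1) * (2 * (c₂ + d₃) - 2 * b₂ - 2 * b₃ - b₂ * c₃) := mul_nonneg hB.le hA₁
    linarith
  have h4 : 2 * P - 4 ≥ 2 * (2 - b₁) + b₂ * (P - 1) := by linarith
  have h5 : b₁ ≤ 2 / 3 * a₁ := by nlinarith
  have h6 : 0 ≤ b₂ * (P - 1) := mul_nonneg hb₂.le (by linarith)
  have h7 : 10 / 3 ≤ P := by linarith
  have h8 : 8 / 27 ≤ b₂ := by nlinarith
  nlinarith

/-- Too many bluffs give `d₁ = 1`, and `c₃ < 1` then forces `a₁ < 1/2` and `P > 4`. Hence Player 1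
is indifferent with `A`, and Player 3's callers are pinned to `c₁ = 1` and indifferent `d₂`; the
resulting equation for `b₁` and `b₂` has no solution with `P > 4`. -/
theorem FirstOrder.mul_b₂_le_two (h : FirstOrder P a₁ b₁ c₁ d₁ 1 b₂ c₂ d₂ b₃ c₃ d₃)
    (hP : 2 ≤ P) (ha : 0 < a₁) : (P + 1) * b₂ ≤ 2 := by
  by_contra! hlt
  have hP2 := h.two_lt_of_a₁_pos hP ha
  have hb₁ := h.b₁_pos hP ha
  have hb₂ := h.b₂_pos hP ha
  have hb₃ := h.b₃_pos hP (by linarith)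
  have hx := h.calls₁_eq hP hb₁
  have hy := h.calls₂_eq hP hb₂
  have hz := h.calls₃_eq hP hb₃
  obtain ⟨hlo, -, -⟩ := h.b₁_bounds hP ha
  obtain ⟨hc₃0, hc₃1⟩ := h.hc₃
  obtain ⟨hc₁0, hc₁1⟩ := h.hc₁
  obtain ⟨hd₂0, hd₂1⟩ := h.hd₂
  have ha1 := h.ha₁.2
  have hB : 0 < P + 1 := by linarith
  obtain rfl := h.D₁.eq_one h.hd₁.2 (by linarith)
  have hP5 : 5 - 2 * a₁ ≤ P := by nlinarith
  have hC₃ := h.C₃.1 (by nlinarith)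
  have hb₁' : (P + 1) * b₁ < 2 * (1 - a₁) := by nlinarith
  have hP4 : 4 < P := by linarith
  have hA₁ := h.A₁.gain_eq_zero ha (by linarith)
  have hc₁ : 0 < c₁ := by nlinarith
  have hd₂ : 0 < d₂ := by nlinarith
  have hD := h.D₂.2 hd₂
  have hbb : b₁ < b₂ := by nlinarith
  obtain rfl := h.C₁.eq_one hc₁1 (by linarith)
  have hD' := hD.antisymm' (h.D₂.1 (by nlinarith))
  have h1 : 2 * P - 6 + b₁ = b₂ * (3 * P - 3 + 2 * a₁) / 2 := by
    have h2 : (P + 1) * (b₂ * c₃) = b₂ * (P - 5 + 2 * a₁) := by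
      linear_combination b₂ * hy
    linear_combination (P + 1) / 2 * hA₁ - hx + hD' + 1 / 2 * h2
  have h3 : 2 * P - 6 + 5 / 2 * b₁ + b₂ * (3 + a₁) / 2 ≤ 3 := by linarith
  have h4 : (2 * P - 6) * (P + 1) + 5 * a₁ + (3 + a₁) ≤ 3 * (P + 1) := by nlinarith
  nlinarith

/-! ### Families 6 to 10 and conclusion of the classification. -/

theorem FirstOrder.mem_of_a₁_lt_one (h : FirstOrder P a₁ b₁ c₁ d₁ 1 b₂ c₂ d₂ b₃ c₃ d₃)
    (hP : 2 ≤ P) (ha : 0 < a₁) (ha1 : a₁ < 1) :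
    ∃ k : Label, P ∈ validRange k ∧
      Profile.mk a₁ b₁ c₁ d₁ 1 b₂ c₂ d₂ b₃ c₃ d₃ ∈ family k P := by
  have hP2 := h.two_lt_of_a₁_pos hP ha
  have hb₁ := h.b₁_pos hP ha
  have hb₂ := h.b₂_pos hP ha
  have hb₃ := h.b₃_pos hP (by linarith)
  have hx := h.calls₁_eq hP hb₁
  have hy := h.calls₂_eq hP hb₂
  have hz := h.calls₃_eq hP hb₃
  have hBb₂ : (P + 1) * b₂ = 2 := (h.mul_b₂_le_two hP ha).antisymm (h.two_le_mul_b₂ hP ha)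
  have hA₁ := h.A₁.gain_eq_zero ha ha1
  have hb₂1 := h.b₂_lt_one hP
  obtain ⟨hc₃0, hc₃1⟩ := h.hc₃
  obtain ⟨hc₁0, hc₁1⟩ := h.hc₁
  obtain ⟨hd₂0, hd₂1⟩ := h.hd₂
  have hB : 0 < P + 1 := by linarith
  have hbet : 2 * P - 6 = (P + 1) * b₃ + c₃ := by
    linear_combination (P + 1) / 2 * hA₁ - hx + (1 + c₃ / 2) * hBb₂
  have hP5 : P < 5 := by
    by_contra! hP5
    have hb₃' : 2 < (P + 1) * b₃ := by linarith
    obtain rfl := h.C₁.eq_one hc₁1 (by linarith)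
    obtain rfl := h.D₂.eq_one hd₂1 (by linarith)
    linarith
  obtain ⟨rfl, hd₃, hBb₁⟩ := h.responses₁_of_lt_five hP ha hP5
  have hbb : b₁ < b₂ := by nlinarith
  -- The gain of `d₂` must vanish: if negative, `c₁` alone supplies the calls only for `P < 3`,
  -- against `hbet`; if positive, both opponents always call Player 3, which is too much.
  rcases lt_trichotomy (b₁ + (P + 1) * b₃ - 2) 0 with hneg | hDe | hpos
  · exfalso
    obtain rfl := h.D₂.eq_zero hd₂0 hneg
    have := h.C₁.2 (by nlinarith)
    nlinarith
  · obtain rfl := h.C₁.eq_one hc₁1 (by linarith)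
    have hBb₃ : (P + 1) * b₃ = 2 - b₁ := by linarith
    have hBc₃ : (P + 1) * c₃ = (P + 1) * (2 * P - 8) + 2 * a₁ := by
      linear_combination (-(P + 1)) * hbet - (P + 1) * hBb₃ + hBb₁
    have hgain : (P + 1) * ((P + a₁) * b₂ + 1 * b₁ - 2 * 1) = 4 * a₁ - 2 := by
      linear_combination (P + a₁) * hBb₂ + hBb₁
    rcases lt_trichotomy a₁ (1 / 2) with hlt | rfl | hgt
    · obtain rfl := h.C₃.eq_zero hc₃0 (by nlinarith)
      have ha₁ : a₁ = (4 - P) * (P + 1) := by linarith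
      have hP4 : P ≤ 4 := by nlinarith
      refine ⟨.s6, ⟨(P₆_le_iff hP).2 (by nlinarith), hP4⟩, h.feasible, ha₁, ?_, rfl, ?_, ?_,
        rfl, ?_, rfl, ?_, rfl, ?_⟩ <;> dsimp
      · apply mul_left_cancel₀ hB.ne'; linarith
      · rw [eq_div_iff hB.ne']; linarith
      · rw [eq_div_iff hB.ne']; linarith
      · rw [eq_div_iff hB.ne']; linarith
      · rw [eq_div_iff hB.ne']; linarith
      · rw [eq_div_iff hB.ne']; linarith
    · refine ⟨.s7, ⟨(P₆_le_iff hP).2 (by nlinarith), (le_P₉_iff hP).2 (by nlinarith)⟩,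
        h.feasible, rfl, ?_, rfl, ?_, ?_, rfl, ?_, ?_, ?_, rfl, ?_⟩ <;> dsimp
      · rw [eq_div_iff hB.ne']; linarith
      · rw [eq_div_iff hB.ne']; linarith
      · rw [eq_div_iff (by positivity)]
        linear_combination (P + 1) * hBb₃ - hBb₁
      · rw [eq_div_iff hB.ne']; linarith
      · rw [eq_div_iff hB.ne']; linarith
      · rw [eq_div_iff hB.ne']; linarith
      · rw [eq_div_iff hB.ne']; linarith
    · obtain rfl := h.C₃.eq_one hc₃1 (by nlinarith)
      have ha₁ : a₁ = (1 / 2) * (9 - 2 * P) * (P + 1) := by linarith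
      refine ⟨.s8, ⟨(P₈_le_iff hP).2 (by nlinarith), (le_P₉_iff hP).2 (by nlinarith)⟩,
        h.feasible, ha₁, ?_, rfl, ?_, ?_, rfl, ?_, rfl, ?_, rfl, ?_⟩ <;> dsimp
      · apply mul_left_cancel₀ hB.ne'; linarith
      · rw [eq_div_iff hB.ne']; linarith
      · rw [eq_div_iff hB.ne']; linarith
      · rw [eq_div_iff hB.ne']; linarith
      · rw [eq_div_iff hB.ne']; linarith
      · rw [eq_div_iff hB.ne']; linarith
  · exfalso
    obtain rfl := h.D₂.eq_one hd₂1 hpos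
    obtain rfl := h.C₁.eq_one hc₁1 (by linarith)
    linarith

theorem FirstOrder.isListed_of_a₁_eq_one (h : FirstOrder P 1 b₁ c₁ d₁ 1 b₂ c₂ d₂ b₃ c₃ d₃)
    (hP : 2 ≤ P) : IsListed P (Profile.mk 1 b₁ c₁ d₁ 1 b₂ c₂ d₂ b₃ c₃ d₃) := by
  have ha : (0 : ℝ) < 1 := one_pos
  have hP2 := h.two_lt_of_a₁_pos hP ha
  have hb₁ := h.b₁_pos hP ha
  have hb₂ := h.b₂_pos hP ha
  have hb₃ := h.b₃_pos hP (by linarith)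
  have hx := h.calls₁_eq hP hb₁
  have hy := h.calls₂_eq hP hb₂
  have hz := h.calls₃_eq hP hb₃
  obtain ⟨hlo, -, -⟩ := h.b₁_bounds hP ha
  have hBb₂ : (P + 1) * b₂ = 2 := (h.mul_b₂_le_two hP ha).antisymm (h.two_le_mul_b₂ hP ha)
  have hA₁ := h.A₁.2 ha
  obtain ⟨hc₁0, hc₁1⟩ := h.hc₁
  obtain ⟨hd₂0, hd₂1⟩ := h.hd₂
  obtain rfl := h.C₃.eq_one h.hc₃.2 (by linarith)
  have hB : 0 < P + 1 := by linarith
  have hd₁0 := h.hd₁.1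
  have hc₁ : 0 < c₁ := by nlinarith
  have hC := h.C₁.2 hc₁
  -- Player 1 is indifferent about `c₁` even when `c₁ = 1`: then `d₂ < 1`, and `b₂ ≤ b₁` puts the
  -- gain of `c₁` below the nonpositive gain of `d₂`.
  have hC' : (P + 1) * b₃ = 2 - b₂ := by
    rcases hc₁1.lt_or_eq with hlt | rfl
    · linarith [h.C₁.1 hlt]
    · have hD := h.D₂.1 (by nlinarith)
      nlinarith
  have hb₂e : b₂ = 2 / (P + 1) := by rw [eq_div_iff hB.ne']; linarith
  have hb₃e : b₃ = 2 * P / (P + 1) ^ 2 := by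
    rw [eq_div_iff (by positivity)]
    linear_combination (P + 1) * hC' - hBb₂
  have hd₁e : d₁ = (P - 3) / (P + 1) := by rw [eq_div_iff hB.ne']; linarith
  rcases lt_trichotomy P 5 with hP5 | rfl | hP5
  · obtain ⟨rfl, hd₃, hBb₁⟩ := h.responses₁_of_lt_five hP ha hP5
    refine Or.inl ⟨.s9, ⟨(P₈_le_iff hP).2 ?_, hP5.le⟩, h.feasible, rfl, ?_, rfl, hb₂e, hb₃e, ?_,
      rfl, hd₁e, rfl, ?_⟩ <;> try dsimp
    · have h1 : 0 ≤ (P + 1) * ((P + 1) * (2 * (0 + d₃) - 2 * b₂ - 2 * b₃ - b₂ * 1)) := by positivity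
      have h2 : (P + 1) * ((P + 1) * (2 * (0 + d₃) - 2 * b₂ - 2 * b₃ - b₂ * 1)) =
          4 * P ^ 2 - 14 * P - 14 := by
        linear_combination 2 * (P + 1) * hd₃ - 2 * (P + 1) * hC' - (3 * (P + 1) - 2) * hBb₂
      linarith
    · rw [eq_div_iff hB.ne']; linarith
    · rw [eq_div_iff hB.ne']; linarith
    · rw [eq_div_iff hB.ne']; linarith
  · obtain ⟨rfl, hc₂, -, hhi⟩ := h.responses₁_of_five_le ha le_rfl
    obtain rfl : c₂ = 0 := by linarith
    refine Or.inr (Or.inr (Or.inr (Or.inr ⟨rfl, h.feasible, rfl, ?_, ?_, rfl, ?_, ?_, ?_, ?_, rfl,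
      ?_, rfl, rfl⟩))) <;> dsimp
    · linarith
    · linarith
    · linarith
    · linarith
    · intro _; linarith
    · intro hgt
      obtain rfl := h.D₂.eq_one hd₂1 (by linarith)
      exact ⟨by linarith, rfl⟩
    · linarith
  · obtain ⟨rfl, hc₂, -, hhi⟩ := h.responses₁_of_five_le ha hP5.le
    have hC₂ := h.C₂.2 (by nlinarith)
    have hPb₁ : P * b₁ = 2 := by linarith
    have hbb : b₂ < b₁ := by nlinarith
    obtain rfl := h.D₂.eq_one hd₂1 (by linarith)
    refine Or.inl ⟨.s10, hP5.le, h.feasible, rfl, ?_, rfl, hb₂e, hb₃e, ?_, rfl, rfl, hd₁e, ?_,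
      rfl⟩ <;> dsimp
    · rw [eq_div_iff (by linarith)]; linarith
    · rw [eq_div_iff hB.ne']; linarith
    · rw [eq_div_iff hB.ne']; linarith

theorem IsNash.isListed {σ : Profile} (hσ : IsNash P σ) (hP : 2 ≤ P) : IsListed P σ := by
  obtain ⟨a₁, b₁, c₁, d₁, a₂, b₂, c₂, d₂, b₃, c₃, d₃⟩ := σ
  have h : FirstOrder P a₁ b₁ c₁ d₁ a₂ b₂ c₂ d₂ b₃ c₃ d₃ := isNash_iff_firstOrder.1 hσ
  rcases h.ha₁.1.eq_or_lt with rfl | ha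
  · exact h.isListed_of_a₁_eq_zero hP
  obtain rfl := h.a₂_eq_one hP ha
  rcases h.ha₁.2.lt_or_eq with ha1 | rfl
  · exact Or.inl (h.mem_of_a₁_lt_one hP ha ha1)
  · exact h.isListed_of_a₁_eq_one hP

end Classification

section Families

variable {P : ℝ} {σ : Profile}

/-! ### Best-reply criteria and the root defining family 3. -/

theorem bestReply_of_eq_zero {g v : ℝ} (hg : g = 0) : BestReply g v :=
  ⟨fun _ => hg.le, fun _ => hg.ge⟩

theorem bestReply_zero {g : ℝ} (hg : g ≤ 0) : BestReply g 0 :=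
  ⟨fun _ => hg, fun h => absurd h (lt_irrefl _)⟩

theorem bestReply_one {g : ℝ} (hg : 0 ≤ g) : BestReply g 1 :=
  ⟨fun h => absurd h (lt_irrefl _), fun _ => hg⟩

theorem BestReply.of_mul {B g v : ℝ} (hB : 0 < B) (h : BestReply (B * g) v) : BestReply g v :=
  ⟨fun hv => nonpos_of_mul_nonpos_right (h.1 hv) hB,
    fun hv => nonneg_of_mul_nonneg_right (h.2 hv) hB⟩

/-- The larger root of the quadratic that determines `a₂` in the third family. -/
noncomputable def betRoot (P : ℝ) : ℝ :=
  (1 / 2) * (4 - P ^ 2 + √(P ^ 4 - 4 * P ^ 3 + 4 * P ^ 2 + 12 * P + 12))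

theorem betRoot_discrim_nonneg (hP : 2 ≤ P) :
    0 ≤ P ^ 4 - 4 * P ^ 3 + 4 * P ^ 2 + 12 * P + 12 := by
  nlinarith [sq_nonneg (P ^ 2 - 2 * P)]

theorem betRoot_quadratic (hP : 2 ≤ P) :
    betRoot P ^ 2 + (P ^ 2 - 4) * betRoot P + (P + 1) * (P ^ 2 - 4 * P + 1) = 0 := by
  have := Real.sq_sqrt (betRoot_discrim_nonneg hP)
  unfold betRoot
  linear_combination (1 / 4) * this

/-- In family 3 the gain of `d₂` has the sign of `1 - 2 * a₂`, so this is the condition for `d₂ =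
0`. -/
theorem half_le_betRoot_iff (hP : 2 ≤ P) : 1 / 2 ≤ betRoot P ↔ P ≤ P₄ := by
  have h1 : 1 / 2 ≤ betRoot P ↔
      P ^ 2 - 3 ≤ √(P ^ 4 - 4 * P ^ 3 + 4 * P ^ 2 + 12 * P + 12) := by
    unfold betRoot
    constructor <;> intro h <;> linarith
  rw [h1, Real.le_sqrt (by nlinarith) (betRoot_discrim_nonneg hP), le_P₄_iff hP]
  have hp : 0 < 2 * P + 1 := by linarith
  have h2 : P ^ 4 - 4 * P ^ 3 + 4 * P ^ 2 + 12 * P + 12 - (P ^ 2 - 3) ^ 2 =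
      (2 * P + 1) * (6 * P + 3 - 2 * P ^ 2) := by ring
  constructor
  · intro h
    linarith [nonneg_of_mul_nonneg_right (h2 ▸ sub_nonneg.2 h) hp]
  · intro h
    linarith [mul_nonneg hp.le (sub_nonneg.2 h)]

/-- The left side is `c₁ ≤ 1` in family 3. -/
theorem two_mul_betRoot_le_iff (hP : 2 ≤ P) : 2 * betRoot P ≤ 5 - P ↔ P₃ ≤ P := by
  have h1 : 2 * betRoot P ≤ 5 - P ↔
      √(P ^ 4 - 4 * P ^ 3 + 4 * P ^ 2 + 12 * P + 12) ≤ P ^ 2 - P + 1 := by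
    unfold betRoot
    constructor <;> intro h <;> linarith
  rw [h1, Real.sqrt_le_left (by nlinarith), P₃_le_iff hP]
  have hp : 0 < P + 1 := by linarith
  have h2 : (P ^ 2 - P + 1) ^ 2 - (P ^ 4 - 4 * P ^ 3 + 4 * P ^ 2 + 12 * P + 12) =
      (P + 1) * (2 * P ^ 2 - (3 * P + 11)) := by ring
  constructor
  · intro h
    linarith [nonneg_of_mul_nonneg_right (h2 ▸ sub_nonneg.2 h) hp]
  · intro h
    linarith [mul_nonneg hp.le (sub_nonneg.2 h)]

/-! ### Members of the families and special sets are equilibria. -/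

theorem solution1_subset (h : P ∈ Set.Icc 2 3) : solution1 P ⊆ nashSet P := by
  rintro ⟨a₁, b₁, c₁, d₁, a₂, b₂, c₂, d₂, b₃, c₃, d₃⟩
    ⟨⟨f1, f2, f3, f4, f5, f6, f7, f8, f9, f10, f11⟩, ha₁, hb₁, ha₂, hb₂, hb₃, hc₁, hd₂, hy, hy',
      hx, hx'⟩
  obtain ⟨hP, hP3⟩ := h
  have hB : 0 < P + 1 := by linarith
  dsimp at *
  subst ha₁ hb₁ ha₂ hb₂ hc₁
  rw [← hb₃] at hy' hx'
  rw [eq_div_iff hB.ne'] at hb₃ hd₂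
  rw [div_le_iff₀ hB] at hy hx
  have hb₃0 := f9.1
  refine isNash_iff_firstOrder.2 ⟨f1, f2, f3, f4, f5, f6, f7, f8, f9, f10, f11, ?_, ?_, ?_, ?_, ?_,
    ?_, ?_, ?_, ?_, ?_, ?_⟩
  · exact bestReply_zero (by linarith)
  · exact bestReply_zero (by linarith)
  · exact bestReply_zero (by linarith)
  · exact bestReply_of_eq_zero (by linarith)
  · exact bestReply_zero (by linarith)
  · exact bestReply_zero (by linarith)
  · exact bestReply_of_eq_zero (by linarith)
  · exact bestReply_of_eq_zero (by linarith)
  · exact bestReply_of_eq_zero (by linarith)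
  · exact bestReply_of_eq_zero (by linarith)
  · exact bestReply_of_eq_zero (by linarith)

theorem solution2_subset (h : P ∈ Set.Icc 3 P₄) : solution2 P ⊆ nashSet P := by
  rintro ⟨a₁, b₁, c₁, d₁, a₂, b₂, c₂, d₂, b₃, c₃, d₃⟩
    ⟨⟨f1, f2, f3, f4, f5, f6, f7, f8, f9, f10, f11⟩, ha₁, hb₁, ha₂, hb₂, hb₃, hc₁, hd₂, hc₃, hd₁,
      hx, hx'⟩
  obtain ⟨hP, hP4⟩ := h
  have hB : 0 < P + 1 := by linarith
  dsimp at *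
  subst ha₁ hb₁ ha₂ hc₁ hc₃
  rw [eq_div_iff hB.ne'] at hb₂ hb₃ hd₂ hd₁
  rw [div_le_iff₀ hB] at hx
  rw [le_div_iff₀ hB] at hx'
  have hb₂0 := f6.1
  refine isNash_iff_firstOrder.2 ⟨f1, f2, f3, f4, f5, f6, f7, f8, f9, f10, f11, ?_, ?_, ?_, ?_, ?_,
    ?_, ?_, ?_, ?_, ?_, ?_⟩
  · exact (bestReply_zero (by linarith)).of_mul hB
  · exact bestReply_zero (by linarith)
  · exact (bestReply_of_eq_zero (by linear_combination hb₂ + (P + 1 / 2) * hb₃)).of_mul hB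
  · exact bestReply_of_eq_zero (by linarith)
  · exact (bestReply_of_eq_zero (by linear_combination 2 * hd₁ - (2 * P - 4) * hb₃)).of_mul hB
  · exact bestReply_of_eq_zero (by linarith)
  · exact bestReply_of_eq_zero (by linarith)
  · exact bestReply_of_eq_zero (by linarith)
  · exact bestReply_of_eq_zero (by linarith)
  · exact bestReply_zero (by linarith)
  · exact bestReply_of_eq_zero (by linarith)

theorem solution3_subset (h : P ∈ Set.Icc P₃ P₄) (hP : 2 ≤ P) : solution3 P ⊆ nashSet P := by
  rintro ⟨a₁, b₁, c₁, d₁, a₂, b₂, c₂, d₂, b₃, c₃, d₃⟩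
    ⟨⟨f1, f2, f3, f4, f5, f6, f7, f8, f9, f10, f11⟩, ha₁, hb₁, ha₂, hb₂, hb₃, hc₁, hd₂, hc₃, hd₁,
      hx, hx'⟩
  have hB : 0 < P + 1 := by linarith
  dsimp at *
  change a₂ = betRoot P at ha₂
  have hq := betRoot_quadratic hP
  have ha := (half_le_betRoot_iff hP).2 h.2
  rw [← ha₂] at hq ha
  have hPa : 0 < P + a₂ := by linarith
  subst ha₁ hb₁ hd₂ hc₃
  rw [eq_div_iff hB.ne'] at hb₂ hc₁ hd₁
  rw [eq_div_iff hPa.ne'] at hb₃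
  rw [div_le_iff₀ hB] at hx
  have hb₂0 := f6.1
  refine isNash_iff_firstOrder.2 ⟨f1, f2, f3, f4, f5, f6, f7, f8, f9, f10, f11, ?_, ?_, ?_, ?_, ?_,
    ?_, ?_, ?_, ?_, ?_, ?_⟩
  · exact bestReply_zero (by linarith)
  · exact bestReply_zero (by linarith)
  · exact bestReply_of_eq_zero (by linarith)
  · exact bestReply_of_eq_zero (by linarith)
  · refine (bestReply_of_eq_zero ?_).of_mul (B := (P + 1) * (P + 1) * (P + a₂)) (by positivity)
    -- After clearing denominators, Player 2's indifference with `A` is exactly the quadratic `hq`.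
    linear_combination 2 * (P + 1) * (P + a₂) * hd₁ - (P + 1) * (P + 1) * (2 + c₁) * hb₃ -
      (P + 1) * (2 - b₂) * hc₁ + (2 * (P + 1) + 2 * P - 4 + 2 * a₂) * hb₂ + 4 * hq
  · exact bestReply_of_eq_zero (by linarith)
  · exact bestReply_of_eq_zero (by linarith)
  · refine (bestReply_zero ?_).of_mul hPa
    have : (P + a₂) * (0 + (P + 1) * b₃ - 2) = 2 - 4 * a₂ := by
      linear_combination (P + 1) * hb₃ - hb₂
    linarith
  · exact bestReply_of_eq_zero (by linarith)
  · exact bestReply_zero (by linarith)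
  · exact bestReply_of_eq_zero (by linarith)

theorem solution4_subset (h : P ∈ Set.Icc P₃ (7 / 2)) (hP : 2 ≤ P) :
    solution4 P ⊆ nashSet P := by
  rintro ⟨a₁, b₁, c₁, d₁, a₂, b₂, c₂, d₂, b₃, c₃, d₃⟩
    ⟨⟨f1, f2, f3, f4, f5, f6, f7, f8, f9, f10, f11⟩, ha₁, hb₁, ha₂, hb₂, hb₃, hc₁, hd₂, hc₃, hd₁,
      hx, hx'⟩
  obtain ⟨hP3, hP7⟩ := h
  rw [P₃_le_iff hP] at hP3
  have hB : 0 < P + 1 := by linarith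
  have hB' : 0 < 3 * (P + 1) := by linarith
  dsimp at *
  subst ha₁ hb₁ ha₂ hc₁ hd₂ hc₃
  rw [eq_div_iff hB.ne'] at hb₂ hd₁
  rw [eq_div_iff hB'.ne'] at hb₃
  rw [div_le_iff₀ hB] at hx
  rw [le_div_iff₀ hB'] at hx'
  have hb₂0 := f6.1
  refine isNash_iff_firstOrder.2 ⟨f1, f2, f3, f4, f5, f6, f7, f8, f9, f10, f11, ?_, ?_, ?_, ?_, ?_,
    ?_, ?_, ?_, ?_, ?_, ?_⟩
  · exact (bestReply_zero (by linarith)).of_mul hB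
  · exact bestReply_zero (by linarith)
  · refine (bestReply_one ?_).of_mul hB'
    have : 3 * (P + 1) * (b₂ + (P + 1 / 2 * (5 - P)) * b₃ - 2) = 2 * P ^ 2 - (3 * P + 11) := by
      linear_combination 3 * hb₂ + (P + 5) / 2 * hb₃
    linarith
  · exact bestReply_of_eq_zero (by linarith)
  · exact (bestReply_of_eq_zero (by linear_combination 2 * hd₁ - hb₃)).of_mul hB
  · exact bestReply_of_eq_zero (by linarith)
  · exact bestReply_of_eq_zero (by linarith)
  · exact bestReply_zero (by linarith)
  · exact bestReply_of_eq_zero (by linarith)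
  · exact bestReply_zero (by linarith)
  · exact bestReply_of_eq_zero (by linarith)

theorem solution5_subset (h : P ∈ Set.Icc (7 / 2) 4) : solution5 P ⊆ nashSet P := by
  rintro ⟨a₁, b₁, c₁, d₁, a₂, b₂, c₂, d₂, b₃, c₃, d₃⟩
    ⟨⟨f1, f2, f3, f4, f5, f6, f7, f8, f9, f10, f11⟩, ha₁, hb₁, ha₂, hb₂, hb₃, hc₁, hd₂, hc₃, hd₁,
      hx, hx'⟩
  obtain ⟨hP7, hP4⟩ := h
  have hB : 0 < P + 1 := by linarith
  dsimp at *
  subst ha₁ hb₁ ha₂ hc₁ hc₃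
  rw [eq_div_iff hB.ne'] at hb₂ hb₃ hd₂ hd₁
  rw [div_le_iff₀ hB] at hx
  rw [le_div_iff₀ hB] at hx'
  have hb₂0 := f6.1
  refine isNash_iff_firstOrder.2 ⟨f1, f2, f3, f4, f5, f6, f7, f8, f9, f10, f11, ?_, ?_, ?_, ?_, ?_,
    ?_, ?_, ?_, ?_, ?_, ?_⟩
  · exact (bestReply_zero (by linarith)).of_mul hB
  · exact bestReply_zero (by linarith)
  · exact bestReply_one (by linarith)
  · exact bestReply_of_eq_zero (by linarith)
  · exact (bestReply_one (by linarith)).of_mul hB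
  · exact bestReply_of_eq_zero (by linarith)
  · exact bestReply_of_eq_zero (by linarith)
  · exact bestReply_of_eq_zero (by linarith)
  · exact bestReply_of_eq_zero (by linarith)
  · exact bestReply_zero (by linarith)
  · exact bestReply_of_eq_zero (by linarith)

theorem solution6_subset (h : P ∈ Set.Icc P₆ 4) (hP : 2 ≤ P) : solution6 P ⊆ nashSet P := by
  rintro ⟨a₁, b₁, c₁, d₁, a₂, b₂, c₂, d₂, b₃, c₃, d₃⟩
    ⟨⟨f1, f2, f3, f4, f5, f6, f7, f8, f9, f10, f11⟩, ha₁, hb₁, ha₂, hb₂, hb₃, hc₁, hd₂, hc₃, hd₁,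
      hc₂, hd₃⟩
  obtain ⟨hP6, hP4⟩ := h
  rw [P₆_le_iff hP] at hP6
  have hB : 0 < P + 1 := by linarith
  dsimp at *
  subst hb₁ ha₂ hc₁ hc₃ hc₂
  rw [eq_div_iff hB.ne'] at hb₂ hb₃ hd₂ hd₁ hd₃
  refine isNash_iff_firstOrder.2 ⟨f1, f2, f3, f4, f5, f6, f7, f8, f9, f10, f11, ?_, ?_, ?_, ?_, ?_,
    ?_, ?_, ?_, ?_, ?_, ?_⟩
  · exact (bestReply_of_eq_zero (by linarith)).of_mul hB
  · exact bestReply_of_eq_zero (by linarith)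
  · refine (bestReply_one ?_).of_mul hB
    have : (P + 1) * (b₂ + (P + 1) * b₃ - 2) = 2 * P ^ 2 - 6 * P - 6 := by
      linear_combination hb₂ + (P + 1) * hb₃
    linarith
  · exact bestReply_of_eq_zero (by linarith)
  · refine (bestReply_one ?_).of_mul hB
    have : (P + 1) * (2 * (0 + d₁) - 2 * b₃ - 2 * (4 - P) * 0 - b₃ * 1) =
        26 + 10 * P - 4 * P ^ 2 := by
      linear_combination 2 * hd₁ - 3 * hb₃
    nlinarith
  · exact bestReply_of_eq_zero (by linarith)
  · exact bestReply_zero (by rw [ha₁]; linarith)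
  · exact bestReply_of_eq_zero (by linarith)
  · exact bestReply_of_eq_zero (by linarith)
  · refine (bestReply_zero ?_).of_mul hB
    have : (P + 1) * ((P + a₁) * b₂ + 1 * (2 * (4 - P)) - 2 * 1) = 4 * a₁ - 2 := by
      linear_combination (P + a₁) * hb₂ - 2 * ha₁
    linarith
  · exact bestReply_of_eq_zero (by linarith)

/-- No range is needed: for family 7 it is already encoded in `c₃` lying between 0 and 1. -/
theorem solution7_subset (hP : 2 ≤ P) : solution7 P ⊆ nashSet P := by
  rintro ⟨a₁, b₁, c₁, d₁, a₂, b₂, c₂, d₂, b₃, c₃, d₃⟩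
    ⟨⟨f1, f2, f3, f4, f5, f6, f7, f8, f9, f10, f11⟩, ha₁, hb₁, ha₂, hb₂, hb₃, hc₁, hd₂, hc₃, hd₁,
      hc₂, hd₃⟩
  have hB : 0 < P + 1 := by linarith
  have hB' : 0 < (P + 1) ^ 2 := by positivity
  dsimp at *
  subst ha₁ ha₂ hc₁ hc₂
  rw [eq_div_iff hB.ne'] at hb₁ hb₂ hc₃ hd₂ hd₁ hd₃
  rw [eq_div_iff hB'.ne'] at hb₃
  have hb₁0 := f2.1
  have hBb₃ : (P + 1) * b₃ = 2 - b₁ := by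
    apply mul_left_cancel₀ hB.ne'
    linear_combination hb₃ + hb₁
  have hbb : b₁ ≤ b₂ := by nlinarith
  refine isNash_iff_firstOrder.2 ⟨f1, f2, f3, f4, f5, f6, f7, f8, f9, f10, f11, ?_, ?_, ?_, ?_, ?_,
    ?_, ?_, ?_, ?_, ?_, ?_⟩
  · refine (bestReply_of_eq_zero ?_).of_mul hB'
    linear_combination 2 * (P + 1) * hd₃ - (2 * (P + 1) + (P + 1) * c₃) * hb₂ - 2 * hb₃ - 2 * hc₃
  · exact bestReply_of_eq_zero (by linarith)
  · exact bestReply_one (by linarith)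
  · exact bestReply_of_eq_zero (by linarith)
  · refine (bestReply_one ?_).of_mul hB'
    have : (P + 1) ^ 2 * (2 * (c₃ + d₁) - 2 * b₃ - b₁ * c₃ - b₃ * 1) = 2 * P ^ 2 - 2 * P - 2 := by
      linear_combination 2 * (P + 1) * (hc₃ + hd₁) - 3 * hb₃ - (P + 1) * c₃ * hb₁ - hc₃
    nlinarith
  · exact bestReply_of_eq_zero (by linarith)
  · exact bestReply_zero (by linarith)
  · exact bestReply_of_eq_zero (by linarith)
  · exact bestReply_of_eq_zero (by linarith)
  · exact (bestReply_of_eq_zero (by linear_combination (P + 1 / 2) * hb₂ + hb₁)).of_mul hB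
  · exact bestReply_of_eq_zero (by linarith)

theorem solution8_subset (h : P ∈ Set.Icc P₈ P₉) (hP : 2 ≤ P) : solution8 P ⊆ nashSet P := by
  rintro ⟨a₁, b₁, c₁, d₁, a₂, b₂, c₂, d₂, b₃, c₃, d₃⟩
    ⟨⟨f1, f2, f3, f4, f5, f6, f7, f8, f9, f10, f11⟩, ha₁, hb₁, ha₂, hb₂, hb₃, hc₁, hd₂, hc₃, hd₁,
      hc₂, hd₃⟩
  obtain ⟨hP8, hP9⟩ := h
  rw [P₈_le_iff hP] at hP8
  rw [le_P₉_iff hP] at hP9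
  have hB : 0 < P + 1 := by linarith
  dsimp at *
  subst hb₁ ha₂ hc₁ hc₃ hc₂
  rw [eq_div_iff hB.ne'] at hb₂ hb₃ hd₂ hd₁ hd₃
  have hb₁0 := f2.1
  refine isNash_iff_firstOrder.2 ⟨f1, f2, f3, f4, f5, f6, f7, f8, f9, f10, f11, ?_, ?_, ?_, ?_, ?_,
    ?_, ?_, ?_, ?_, ?_, ?_⟩
  · exact (bestReply_of_eq_zero (by linarith)).of_mul hB
  · exact bestReply_of_eq_zero (by linarith)
  · refine (bestReply_one ?_).of_mul hB
    have : (P + 1) * (b₂ + (P + 1) * b₃ - 2) = 2 * P ^ 2 - 7 * P - 7 := by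
      linear_combination hb₂ + (P + 1) * hb₃
    linarith
  · exact bestReply_of_eq_zero (by linarith)
  · refine (bestReply_one ?_).of_mul hB
    have : (P + 1) * (2 * (1 + d₁) - 2 * b₃ - (9 - 2 * P) * 1 - b₃ * 1) =
        22 + 5 * P - 2 * P ^ 2 := by
      linear_combination 2 * hd₁ - 3 * hb₃
    linarith
  · exact bestReply_of_eq_zero (by linarith)
  · exact bestReply_zero (by rw [ha₁]; linarith)
  · exact bestReply_of_eq_zero (by linarith)
  · exact bestReply_of_eq_zero (by linarith)
  · refine (bestReply_one ?_).of_mul hB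
    have : (P + 1) * ((P + a₁) * b₂ + 1 * (9 - 2 * P) - 2 * 1) = 4 * a₁ - 2 := by
      linear_combination (P + a₁) * hb₂ - 2 * ha₁
    linarith
  · exact bestReply_of_eq_zero (by linarith)

theorem solution9_subset (h : P ∈ Set.Icc P₈ 5) (hP : 2 ≤ P) : solution9 P ⊆ nashSet P := by
  rintro ⟨a₁, b₁, c₁, d₁, a₂, b₂, c₂, d₂, b₃, c₃, d₃⟩
    ⟨⟨f1, f2, f3, f4, f5, f6, f7, f8, f9, f10, f11⟩, ha₁, hb₁, ha₂, hb₂, hb₃, hz, hc₃, hd₁,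
      hc₂, hd₃⟩
  obtain ⟨hP8, hP5⟩ := h
  rw [P₈_le_iff hP] at hP8
  have hB : 0 < P + 1 := by linarith
  have hB' : 0 < (P + 1) ^ 2 := by positivity
  dsimp at *
  subst ha₁ ha₂ hc₃ hc₂
  rw [eq_div_iff hB.ne'] at hb₁ hb₂ hz hd₁ hd₃
  rw [eq_div_iff hB'.ne'] at hb₃
  have hb₁0 := f2.1
  have hb₃0 := f9.1
  have hc₁1 := f3.2
  have hBb₃ : (P + 1) * b₃ = 2 - b₂ := by
    apply mul_left_cancel₀ hB.ne'
    linear_combination hb₃ + hb₂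
  have hbb : b₁ = b₂ := by
    apply mul_left_cancel₀ hB.ne'
    linarith
  refine isNash_iff_firstOrder.2 ⟨f1, f2, f3, f4, f5, f6, f7, f8, f9, f10, f11, ?_, ?_, ?_, ?_, ?_,
    ?_, ?_, ?_, ?_, ?_, ?_⟩
  · refine (bestReply_one ?_).of_mul hB'
    have : (P + 1) ^ 2 * (2 * (0 + d₃) - 2 * b₂ - 2 * b₃ - b₂ * 1) = 4 * P ^ 2 - 14 * P - 14 := by
      linear_combination 2 * (P + 1) * hd₃ - 3 * (P + 1) * hb₂ - 2 * hb₃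
    linarith
  · exact bestReply_of_eq_zero (by linarith)
  · exact bestReply_of_eq_zero (by linarith)
  · exact bestReply_of_eq_zero (by linarith)
  · refine (bestReply_one ?_).of_mul hB
    -- Only the sum `c₁ + d₂` is prescribed, so the gain of `a₂` is estimated with the worst case
    -- `c₁ = 1`.
    have : (P + 1) * (b₃ * c₁) ≤ (P + 1) * b₃ :=
      mul_le_mul_of_nonneg_left (mul_le_of_le_one_right hb₃0 hc₁1) hB.le
    nlinarith
  · exact bestReply_of_eq_zero (by linarith)
  · exact bestReply_zero (by linarith)
  · exact bestReply_of_eq_zero (by linarith)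
  · exact bestReply_of_eq_zero (by linarith)
  · exact bestReply_one (by linarith)
  · exact bestReply_of_eq_zero (by linarith)

theorem solution10_subset (hP : 5 ≤ P) : solution10 P ⊆ nashSet P := by
  rintro ⟨a₁, b₁, c₁, d₁, a₂, b₂, c₂, d₂, b₃, c₃, d₃⟩
    ⟨⟨f1, f2, f3, f4, f5, f6, f7, f8, f9, f10, f11⟩, ha₁, hb₁, ha₂, hb₂, hb₃, hc₁, hd₂, hc₃, hd₁,
      hc₂, hd₃⟩
  have hB : 0 < P + 1 := by linarith
  have hB' : 0 < (P + 1) ^ 2 := by positivity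
  dsimp at *
  subst ha₁ ha₂ hd₂ hc₃ hd₃
  rw [eq_div_iff hB.ne'] at hb₂ hc₁ hd₁ hc₂
  rw [eq_div_iff (by linarith)] at hb₁
  rw [eq_div_iff hB'.ne'] at hb₃
  have hb₁0 := f2.1
  have hb₃0 := f9.1
  have hc₁1 := f3.2
  have hBb₃ : (P + 1) * b₃ = 2 - b₂ := by
    apply mul_left_cancel₀ hB.ne'
    linear_combination hb₃ + hb₂
  have hbb : b₂ ≤ b₁ := by nlinarith
  refine isNash_iff_firstOrder.2 ⟨f1, f2, f3, f4, f5, f6, f7, f8, f9, f10, f11, ?_, ?_, ?_, ?_, ?_,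
    ?_, ?_, ?_, ?_, ?_, ?_⟩
  · refine (bestReply_one ?_).of_mul hB'
    have : (P + 1) ^ 2 * (2 * (c₂ + 1) - 2 * b₂ - 2 * b₃ - b₂ * 1) =
        4 * P ^ 2 - 14 * P - 14 := by
      linear_combination 2 * (P + 1) * hc₂ - 3 * (P + 1) * hb₂ - 2 * hb₃
    nlinarith
  · exact bestReply_of_eq_zero (by linarith)
  · exact bestReply_of_eq_zero (by linarith)
  · exact bestReply_of_eq_zero (by linarith)
  · refine (bestReply_one ?_).of_mul hB
    have : (P + 1) * (b₃ * c₁) ≤ (P + 1) * b₃ :=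
      mul_le_mul_of_nonneg_left (mul_le_of_le_one_right hb₃0 hc₁1) hB.le
    nlinarith [f2.2]
  · exact bestReply_of_eq_zero (by linarith)
  · exact bestReply_of_eq_zero (by linarith)
  · exact bestReply_one (by linarith)
  · exact bestReply_of_eq_zero (by linarith)
  · exact bestReply_one (by linarith)
  · exact bestReply_one (by linarith)

theorem solution1a_subset : solution1a ⊆ nashSet 2 := by
  rintro ⟨a₁, b₁, c₁, d₁, a₂, b₂, c₂, d₂, b₃, c₃, d₃⟩
    ⟨⟨f1, f2, f3, f4, f5, f6, f7, f8, f9, f10, f11⟩, ha₁, hb₁, ha₂, hb₂, hb₃, hb₃', hc₁, hd₂, hy,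
      hx⟩
  dsimp at *
  subst ha₁ hb₁ ha₂ hb₂ hc₁ hd₂
  have := f4.1
  have := f7.1
  have := f10.1
  have := f11.1
  refine isNash_iff_firstOrder.2 ⟨f1, f2, f3, f4, f5, f6, f7, f8, f9, f10, f11, ?_, ?_, ?_, ?_, ?_,
    ?_, ?_, ?_, ?_, ?_, ?_⟩
  all_goals first | exact bestReply_of_eq_zero (by linarith) | exact bestReply_zero (by linarith)

theorem solution2a_subset : solution2a ⊆ nashSet 3 := by
  rintro ⟨a₁, b₁, c₁, d₁, a₂, b₂, c₂, d₂, b₃, c₃, d₃⟩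
    ⟨⟨f1, f2, f3, f4, f5, f6, f7, f8, f9, f10, f11⟩, ha₁, hb₁, hb₂, ha₂, hb₃, hc₁, hd₂, hc₃, hd₁,
      hx, hx'⟩
  dsimp at *
  subst ha₁ hb₁ hb₃ hc₁ hc₃ hd₁
  have ha₂0 := f5.1
  refine isNash_iff_firstOrder.2 ⟨f1, f2, f3, f4, f5, f6, f7, f8, f9, f10, f11, ?_, ?_, ?_, ?_, ?_,
    ?_, ?_, ?_, ?_, ?_, ?_⟩
  · exact bestReply_zero (by linarith)
  · exact bestReply_zero (by linarith)
  · exact bestReply_zero (by linarith)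
  all_goals first | exact bestReply_of_eq_zero (by linarith) | exact bestReply_zero (by linarith)

theorem solution5a_subset : solution5a ⊆ nashSet (7 / 2) := by
  rintro ⟨a₁, b₁, c₁, d₁, a₂, b₂, c₂, d₂, b₃, c₃, d₃⟩
    ⟨⟨f1, f2, f3, f4, f5, f6, f7, f8, f9, f10, f11⟩, ha₁, hb₁, hb₂, ha₂, hb₃, hc₁, hd₂, hc₃, hd₁,
      hx, hx'⟩
  dsimp at *
  subst ha₁ hb₁ hb₃ hc₁ hc₃ hd₁
  have ha₂0 := f5.1
  refine isNash_iff_firstOrder.2 ⟨f1, f2, f3, f4, f5, f6, f7, f8, f9, f10, f11, ?_, ?_, ?_, ?_, ?_,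
    ?_, ?_, ?_, ?_, ?_, ?_⟩
  · exact bestReply_zero (by linarith)
  · exact bestReply_zero (by linarith)
  · exact bestReply_one (by linarith)
  all_goals first | exact bestReply_of_eq_zero (by linarith) | exact bestReply_zero (by linarith)

theorem solution10a_subset : solution10a ⊆ nashSet 5 := by
  rintro ⟨a₁, b₁, c₁, d₁, a₂, b₂, c₂, d₂, b₃, c₃, d₃⟩
    ⟨⟨f1, f2, f3, f4, f5, f6, f7, f8, f9, f10, f11⟩, ha₁, hb₁, hb₁', ha₂, hb₂, hb₃, hz, hz', hc₃,
      hd₁, hc₂, hd₃⟩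
  dsimp at *
  subst ha₁ ha₂ hb₂ hb₃ hc₃ hd₁ hc₂ hd₃
  have hc₁1 := f3.2
  have hsum : c₁ + d₂ = 5 / 3 := by
    rcases hb₁.eq_or_lt with hb | hb
    · exact hz hb.symm
    · obtain ⟨rfl, rfl⟩ := hz' hb
      norm_num
  refine isNash_iff_firstOrder.2 ⟨f1, f2, f3, f4, f5, f6, f7, f8, f9, f10, f11, ?_, ?_, ?_, ?_, ?_,
    ?_, ?_, ?_, ?_, ?_, ?_⟩
  · exact bestReply_one (by linarith)
  · exact bestReply_of_eq_zero (by linarith)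
  · exact bestReply_of_eq_zero (by linarith)
  · exact bestReply_of_eq_zero (by linarith)
  · exact bestReply_one (by linarith)
  · exact bestReply_of_eq_zero (by linarith)
  · exact bestReply_zero (by linarith)
  · rcases hb₁.eq_or_lt with rfl | hb
    · exact bestReply_of_eq_zero (by linarith)
    · obtain ⟨rfl, rfl⟩ := hz' hb
      exact bestReply_one (by linarith)
  · exact bestReply_of_eq_zero (by linarith)
  · exact bestReply_one (by linarith)
  · exact bestReply_one (by linarith)

/-! ### Necessity of the ranges. -/

theorem le_three_of_mem_solution1 (hP : 2 ≤ P) (hσ : σ ∈ solution1 P) : P ≤ 3 := by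
  obtain ⟨-, -, -, -, -, -, -, -, hy, hy', -⟩ := hσ
  have := (div_le_div_iff_of_pos_right (show 0 < P + 1 by linarith)).1 (hy.trans hy')
  linarith

theorem mem_Icc_of_mem_solution2 (hP : 2 ≤ P) (hσ : σ ∈ solution2 P) : P ∈ Set.Icc 3 P₄ := by
  obtain ⟨hf, -, -, -, -, -, hc₁, hd₂, -⟩ := hσ
  obtain ⟨-, -, f3, -, -, -, -, f8, -⟩ := hf
  have hB : 0 < P + 1 := by linarith
  have h1 := f3.1
  have h2 := f8.1
  rw [hc₁] at h1
  rw [hd₂, le_div_iff₀ hB] at h2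
  exact ⟨by linarith, (le_P₄_iff hP).2 (by linarith)⟩

theorem mem_Icc_of_mem_solution3 (hP : 2 ≤ P) (hσ : σ ∈ solution3 P) (hN : IsNash P σ) :
    P ∈ Set.Icc P₃ P₄ := by
  obtain ⟨hf, -, -, ha₂, hb₂, hb₃, hc₁, hd₂, -⟩ := hσ
  obtain ⟨-, f2, f3, -, f5, -⟩ := hf
  have hB : 0 < P + 1 := by linarith
  have hPa : 0 < P + σ.a₂ := by linarith [f5.1]
  change σ.a₂ = betRoot P at ha₂
  have h1 := f3.2
  rw [hc₁, div_le_iff₀ hB] at h1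
  have h2 := (isNash_iff_firstOrder.1 hN).D₂.1 (by rw [hd₂]; exact one_pos)
  have h3 : σ.b₃ * (P + σ.a₂) = 2 - σ.b₂ := by rw [hb₃, div_mul_cancel₀ _ hPa.ne']
  have h4 : σ.b₂ * (P + 1) = 2 * σ.a₂ := by rw [hb₂, div_mul_cancel₀ _ hB.ne']
  have h5 : (P + σ.a₂) * ((P + 1) * σ.b₃) ≤ (P + σ.a₂) * 2 :=
    mul_le_mul_of_nonneg_left (by linarith [f2.1]) hPa.le
  have h6 : 1 / 2 ≤ σ.a₂ := by
    have : (P + σ.a₂) * ((P + 1) * σ.b₃) = 2 * (P + 1) - 2 * σ.a₂ := by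
      linear_combination (P + 1) * h3 - h4
    linarith
  rw [ha₂] at h1 h6
  exact ⟨(two_mul_betRoot_le_iff hP).1 (by linarith), (half_le_betRoot_iff hP).1 h6⟩

theorem mem_Icc_of_mem_solution4 (hP : 2 ≤ P) (hσ : σ ∈ solution4 P) (hN : IsNash P σ) :
    P ∈ Set.Icc P₃ (7 / 2) := by
  obtain ⟨hf, -, hb₁, ha₂, hb₂, hb₃, hc₁, hd₂, -⟩ := hσ
  have hB : 0 < P + 1 := by linarith
  have hB' : 0 < 3 * (P + 1) := by linarith
  have h := isNash_iff_firstOrder.1 hN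
  have hC := h.C₁.2 (by rw [hc₁]; exact one_pos)
  have hD := h.D₂.1 (by rw [hd₂]; exact one_pos)
  rw [eq_div_iff hB.ne'] at hb₂
  rw [eq_div_iff hB'.ne'] at hb₃
  have h1 : 3 * (P + 1) * (σ.b₂ + (P + σ.a₂) * σ.b₃ - 2) = 2 * P ^ 2 - (3 * P + 11) := by
    rw [ha₂]
    linear_combination 3 * hb₂ + (P + 5) / 2 * hb₃
  have h2 := mul_nonneg hB'.le hC
  exact ⟨(P₃_le_iff hP).2 (by linarith), by linarith⟩

theorem mem_Icc_of_mem_solution5 (hP : 2 ≤ P) (hσ : σ ∈ solution5 P) (hN : IsNash P σ) :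
    P ∈ Set.Icc (7 / 2) 4 := by
  obtain ⟨hf, -, hb₁, ha₂, hb₂, hb₃, hc₁, -, hc₃, hd₁, hx, hx'⟩ := hσ
  have hB : 0 < P + 1 := by linarith
  have hA := (isNash_iff_firstOrder.1 hN).A₂.2 (by rw [ha₂]; exact one_pos)
  have h1 := (div_le_div_iff_of_pos_right hB).1 (hx.trans hx')
  rw [eq_div_iff hB.ne'] at hb₃ hd₁
  rw [hc₁, hc₃] at hA
  have h2 : (P + 1) * (2 * (0 + σ.d₁) - 2 * σ.b₃ - σ.b₁ * 0 - σ.b₃ * 1) = 4 * P - 14 := by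
    linear_combination 2 * hd₁ - 3 * hb₃
  have h3 := mul_nonneg hB.le hA
  exact ⟨by linarith, by linarith⟩

/-- `P ≤ 4` is `b₁ ≥ 0`; the lower end is `a₁ ≤ 1/2`, the condition for `c₃ = 0` to be a best reply.
-/
theorem mem_Icc_of_mem_solution6 (hP : 2 ≤ P) (hσ : σ ∈ solution6 P) (hN : IsNash P σ) :
    P ∈ Set.Icc P₆ 4 := by
  obtain ⟨hf, ha₁, hb₁, ha₂, hb₂, -, -, -, hc₃, -⟩ := hσ
  have hB : 0 < P + 1 := by linarith
  have hC := (isNash_iff_firstOrder.1 hN).C₃.1 (by rw [hc₃]; exact one_pos)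
  have h0 := hf.2.1.1
  rw [hb₁] at h0
  rw [eq_div_iff hB.ne'] at hb₂
  have h1 : (P + 1) * ((P + σ.a₁) * σ.b₂ + σ.a₂ * σ.b₁ - 2 * σ.a₂) = 4 * σ.a₁ - 2 := by
    rw [ha₂, hb₁]
    linear_combination (P + σ.a₁) * hb₂ - 2 * ha₁
  have h2 := mul_nonpos_of_nonneg_of_nonpos hB.le hC
  rw [h1, ha₁] at h2
  exact ⟨(P₆_le_iff hP).2 (by linarith), by linarith⟩

theorem mem_Icc_of_mem_solution7 (hP : 2 ≤ P) (hσ : σ ∈ solution7 P) : P ∈ Set.Icc P₆ P₉ := by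
  obtain ⟨hf, -, -, -, -, -, -, -, hc₃, -⟩ := hσ
  have hB : 0 < P + 1 := by linarith
  obtain ⟨-, -, -, -, -, -, -, -, -, ⟨h0, h1⟩, -⟩ := hf
  rw [hc₃, le_div_iff₀ hB] at h0
  rw [hc₃, div_le_iff₀ hB] at h1
  exact ⟨(P₆_le_iff hP).2 (by linarith), (le_P₉_iff hP).2 (by linarith)⟩

/-- `a₁ ≤ 1` gives the lower end, and `a₁ ≥ 1/2`, needed for `c₃ = 1`, the upper. -/
theorem mem_Icc_of_mem_solution8 (hP : 2 ≤ P) (hσ : σ ∈ solution8 P) (hN : IsNash P σ) :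
    P ∈ Set.Icc P₈ P₉ := by
  obtain ⟨hf, ha₁, hb₁, ha₂, hb₂, -, -, -, hc₃, -⟩ := hσ
  have hB : 0 < P + 1 := by linarith
  have hC := (isNash_iff_firstOrder.1 hN).C₃.2 (by rw [hc₃]; exact one_pos)
  have h0 := hf.1.2
  rw [eq_div_iff hB.ne'] at hb₂
  have h1 : (P + 1) * ((P + σ.a₁) * σ.b₂ + σ.a₂ * σ.b₁ - 2 * σ.a₂) = 4 * σ.a₁ - 2 := by
    rw [ha₂, hb₁]
    linear_combination (P + σ.a₁) * hb₂ - 2 * ha₁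
  have h2 := mul_nonneg hB.le hC
  rw [h1, ha₁] at h2
  rw [ha₁] at h0
  exact ⟨(P₈_le_iff hP).2 (by linarith), (le_P₉_iff hP).2 (by linarith)⟩

theorem mem_Icc_of_mem_solution9 (hP : 2 ≤ P) (hσ : σ ∈ solution9 P) (hN : IsNash P σ) :
    P ∈ Set.Icc P₈ 5 := by
  obtain ⟨hf, ha₁, hb₁, ha₂, hb₂, hb₃, -, hc₃, -, hc₂, hd₃⟩ := hσ
  have hB : 0 < P + 1 := by linarith
  have hB' : 0 < (P + 1) ^ 2 := by positivity
  have hA := (isNash_iff_firstOrder.1 hN).A₁.2 (by rw [ha₁]; exact one_pos)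
  obtain ⟨-, -, -, -, -, -, -, -, -, -, -, h0⟩ := hf
  rw [eq_div_iff hB.ne'] at hb₂ hd₃
  rw [eq_div_iff hB'.ne'] at hb₃
  have h1 : (P + 1) ^ 2 * (2 * (σ.c₂ + σ.d₃) - 2 * σ.b₂ - 2 * σ.b₃ - σ.b₂ * σ.c₃) =
      4 * P ^ 2 - 14 * P - 14 := by
    rw [hc₂, hc₃]
    linear_combination 2 * (P + 1) * hd₃ - 3 * (P + 1) * hb₂ - 2 * hb₃
  have h2 := mul_nonneg hB'.le hA
  exact ⟨(P₈_le_iff hP).2 (by linarith), by nlinarith⟩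

theorem five_le_of_mem_solution10 (hP : 2 ≤ P) (hσ : σ ∈ solution10 P) : 5 ≤ P := by
  obtain ⟨hf, -, -, -, -, -, -, -, -, -, hc₂, -⟩ := hσ
  obtain ⟨-, -, -, -, -, -, ⟨h0, -⟩, -⟩ := hf
  rw [hc₂, le_div_iff₀ (by linarith)] at h0
  linarith

theorem family_subset_nashSet {k : Label} (hP : 2 ≤ P) (hk : P ∈ validRange k) :
    family k P ⊆ nashSet P := by
  cases k
  exacts [solution1_subset hk, solution2_subset hk, solution3_subset hk hP,
    solution4_subset hk hP, solution5_subset hk, solution6_subset hk hP, solution7_subset hP,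
    solution8_subset hk hP, solution9_subset hk hP, solution10_subset hk]

theorem mem_validRange {k : Label} (hP : 2 ≤ P) (hσ : σ ∈ family k P) (hN : IsNash P σ) :
    P ∈ validRange k := by
  cases k
  exacts [⟨hP, le_three_of_mem_solution1 hP hσ⟩, mem_Icc_of_mem_solution2 hP hσ,
    mem_Icc_of_mem_solution3 hP hσ hN, mem_Icc_of_mem_solution4 hP hσ hN,
    mem_Icc_of_mem_solution5 hP hσ hN, mem_Icc_of_mem_solution6 hP hσ hN,
    mem_Icc_of_mem_solution7 hP hσ, mem_Icc_of_mem_solution8 hP hσ hN,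
    mem_Icc_of_mem_solution9 hP hσ hN, five_le_of_mem_solution10 hP hσ]

theorem isNash_iff_isListed (hP : 2 ≤ P) : IsNash P σ ↔ IsListed P σ := by
  refine ⟨fun h => h.isListed hP, ?_⟩
  rintro (⟨k, hk, hσ⟩ | ⟨rfl, hσ⟩ | ⟨rfl, hσ⟩ | ⟨rfl, hσ⟩ | ⟨rfl, hσ⟩)
  exacts [family_subset_nashSet hP hk hσ, solution1a_subset hσ, solution2a_subset hσ,
    solution5a_subset hσ, solution10a_subset hσ]

/-! ### Explicit members of the families. -/

theorem div_mem_Icc {x y : ℝ} (hy : 0 < y) (hx : 0 ≤ x) (hxy : x ≤ y) :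
    x / y ∈ Set.Icc (0 : ℝ) 1 :=
  ⟨div_nonneg hx hy.le, (div_le_one hy).2 hxy⟩

theorem zero_mem_Icc_zero_one : (0 : ℝ) ∈ Set.Icc (0 : ℝ) 1 := ⟨le_rfl, zero_le_one⟩

theorem one_mem_Icc_zero_one : (1 : ℝ) ∈ Set.Icc (0 : ℝ) 1 := ⟨zero_le_one, le_rfl⟩

theorem half_mem_Icc_zero_one : (1 / 2 : ℝ) ∈ Set.Icc (0 : ℝ) 1 := by constructor <;> norm_num

theorem solution1_nonempty (h : P ∈ Set.Icc 2 3) : (solution1 P).Nonempty := by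
  obtain ⟨hP, hP3⟩ := h
  have hB : 0 < P + 1 := by linarith
  have hL : (2 * P - 4) / (P + 1) ≤ 2 / (P + 1) :=
    div_le_div_of_nonneg_right (by linarith) hB.le
  have hL1 := div_mem_Icc hB (show 0 ≤ 2 * P - 4 by linarith) (by linarith)
  refine ⟨⟨0, 0, 0, (2 * P - 4) / (P + 1), 0, 0, 0, (2 * P - 4) / (P + 1), 2 / (P + 1), 0,
    (2 * P - 4) / (P + 1)⟩, ⟨zero_mem_Icc_zero_one, zero_mem_Icc_zero_one, zero_mem_Icc_zero_one,
    hL1, zero_mem_Icc_zero_one, zero_mem_Icc_zero_one, zero_mem_Icc_zero_one, hL1,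
    div_mem_Icc hB (by linarith) (by linarith), zero_mem_Icc_zero_one, hL1⟩,
    rfl, rfl, rfl, rfl, rfl, rfl, rfl, ?_, ?_, ?_, ?_⟩ <;> dsimp <;> linarith

theorem solution2_nonempty (h : P ∈ Set.Icc 3 P₄) : (solution2 P).Nonempty := by
  obtain ⟨hP, hP4⟩ := h
  rw [le_P₄_iff (by linarith)] at hP4
  have hP7 : P ≤ 7 / 2 := by nlinarith
  have hB : 0 < P + 1 := by linarith
  have hL : (2 * P - 4) / (P + 1) ≤ 3 / (P + 1) :=
    div_le_div_of_nonneg_right (by linarith) hB.le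
  have hL1 := div_mem_Icc hB (show 0 ≤ 2 * P - 4 by linarith) (by linarith)
  refine ⟨⟨0, 0, 2 * P - 6, (2 * P - 4) / (P + 1), 1 / 2, 1 / (P + 1), 0,
    (3 + 6 * P - 2 * P ^ 2) / (P + 1), 2 / (P + 1), 0, (2 * P - 4) / (P + 1)⟩,
    ⟨zero_mem_Icc_zero_one, zero_mem_Icc_zero_one, ⟨by dsimp; linarith, by dsimp; linarith⟩,
    hL1, half_mem_Icc_zero_one, div_mem_Icc hB (by linarith) (by linarith),
    zero_mem_Icc_zero_one, div_mem_Icc hB (by linarith) (by nlinarith),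
    div_mem_Icc hB (by linarith) (by linarith), zero_mem_Icc_zero_one, hL1⟩,
    rfl, rfl, rfl, rfl, rfl, rfl, rfl, rfl, rfl, ?_, ?_⟩ <;> dsimp <;> linarith

theorem solution3_nonempty (h : P ∈ Set.Icc P₃ P₄) (hP : 2 ≤ P) : (solution3 P).Nonempty := by
  obtain ⟨hP3, hP4⟩ := h
  have ha := (half_le_betRoot_iff hP).2 hP4
  have ha' := (two_mul_betRoot_le_iff hP).2 hP3
  have hq := betRoot_quadratic hP
  have hroot : betRoot P =
    (1 / 2) * (4 - P ^ 2 + √(P ^ 4 - 4 * P ^ 3 + 4 * P ^ 2 + 12 * P + 12)) := rfl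
  -- From here on only the bounds, the quadratic `hq` and the defining formula `hroot` of the root
  -- matter.
  generalize betRoot P = a at *
  rw [P₃_le_iff hP] at hP3
  rw [le_P₄_iff hP] at hP4
  have hP3' : 3 ≤ P := by nlinarith
  have hP7 : P ≤ 7 / 2 := by nlinarith
  have hB : 0 < P + 1 := by linarith
  have hPa : 0 < P + a := by linarith
  have hL1 := div_mem_Icc hB (show 0 ≤ 2 * P - 4 by linarith) (by linarith)
  have hb₂ := div_mem_Icc hB (show 0 ≤ 2 * a by linarith) (by linarith)
  refine ⟨⟨0, 0, (2 * P - 4 + 2 * a) / (P + 1), (2 * P - 4) / (P + 1), a, 2 * a / (P + 1), 0,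
    0, (2 - 2 * a / (P + 1)) / (P + a), 0, (2 * P - 4) / (P + 1)⟩,
    ⟨zero_mem_Icc_zero_one, zero_mem_Icc_zero_one, div_mem_Icc hB (by linarith) (by linarith),
    hL1, ⟨by dsimp; linarith, by dsimp; linarith⟩, hb₂,
    zero_mem_Icc_zero_one, zero_mem_Icc_zero_one,
    div_mem_Icc hPa (by linarith [hb₂.2]) (by linarith [hb₂.1]), zero_mem_Icc_zero_one, hL1⟩,
    rfl, rfl, hroot, rfl, rfl, rfl, rfl, rfl, rfl, ?_, ?_⟩ <;> dsimp
  · linarith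
  · rw [zero_add, div_add_div _ _ hB.ne' hPa.ne', div_le_div_iff₀ hB (mul_pos hB hPa)]
    have e : 2 * a / (P + 1) * (P + 1) = 2 * a := div_mul_cancel₀ _ hB.ne'
    have : (2 * P - 4) * (P + a) ≤ 2 * a * (P + a) + (2 * (P + 1) - 2 * a) := by nlinarith
    nlinarith

theorem solution4_nonempty (h : P ∈ Set.Icc P₃ (7 / 2)) (hP : 2 ≤ P) :
    (solution4 P).Nonempty := by
  obtain ⟨hP3, hP7⟩ := h
  rw [P₃_le_iff hP] at hP3
  have hP3' : 3 ≤ P := by nlinarith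
  have hB : 0 < P + 1 := by linarith
  have hB' : 0 < 3 * (P + 1) := by linarith
  have hL1 := div_mem_Icc hB (show 0 ≤ 2 * P - 4 by linarith) (by linarith)
  refine ⟨⟨0, 0, 1, (2 * P - 4) / (P + 1), (1 / 2) * (5 - P), (5 - P) / (P + 1), 0,
    0, 4 * (P - 2) / (3 * (P + 1)), 0, (2 * P - 4) / (P + 1)⟩,
    ⟨zero_mem_Icc_zero_one, zero_mem_Icc_zero_one, one_mem_Icc_zero_one,
    hL1, ⟨by dsimp; linarith, by dsimp; linarith⟩, div_mem_Icc hB (by linarith) (by linarith),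
    zero_mem_Icc_zero_one, zero_mem_Icc_zero_one,
    div_mem_Icc hB' (by linarith) (by linarith), zero_mem_Icc_zero_one, hL1⟩,
    rfl, rfl, rfl, rfl, rfl, rfl, rfl, rfl, rfl, ?_, ?_⟩ <;> dsimp
  · linarith
  · rw [zero_add, div_le_div_iff₀ hB hB']
    nlinarith

theorem solution5_nonempty (h : P ∈ Set.Icc (7 / 2) 4) : (solution5 P).Nonempty := by
  obtain ⟨hP, hP4⟩ := h
  have hB : 0 < P + 1 := by linarith
  have hL : (2 * P - 4) / (P + 1) ≤ 4 / (P + 1) :=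
    div_le_div_of_nonneg_right (by linarith) hB.le
  have hL1 := div_mem_Icc hB (show 0 ≤ 2 * P - 4 by linarith) (by linarith)
  have hb := div_mem_Icc hB (show (0 : ℝ) ≤ 2 by norm_num) (by linarith)
  refine ⟨⟨0, 0, 1, (2 * P - 4) / (P + 1), 1, 2 / (P + 1), 0, (P - 3) / (P + 1), 2 / (P + 1), 0,
    (2 * P - 4) / (P + 1)⟩, ⟨zero_mem_Icc_zero_one, zero_mem_Icc_zero_one, one_mem_Icc_zero_one,
    hL1, one_mem_Icc_zero_one, hb, zero_mem_Icc_zero_one,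
    div_mem_Icc hB (by linarith) (by linarith), hb, zero_mem_Icc_zero_one, hL1⟩,
    rfl, rfl, rfl, rfl, rfl, rfl, rfl, rfl, rfl, ?_, ?_⟩ <;> dsimp <;> linarith

theorem solution6_nonempty (h : P ∈ Set.Icc P₆ 4) (hP : 2 ≤ P) : (solution6 P).Nonempty := by
  obtain ⟨hP6, hP4⟩ := h
  rw [P₆_le_iff hP] at hP6
  have hP7 : 7 / 2 ≤ P := by nlinarith
  have hB : 0 < P + 1 := by linarith
  exact ⟨⟨(4 - P) * (P + 1), 2 * (4 - P), 1, (4 + 8 * P - 2 * P ^ 2) / (P + 1), 1, 2 / (P + 1), 0,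
    (5 + 7 * P - 2 * P ^ 2) / (P + 1), 2 * (P - 3) / (P + 1), 0, (2 * P - 4) / (P + 1)⟩,
    ⟨⟨mul_nonneg (by linarith) hB.le, by dsimp; linarith⟩,
    ⟨by dsimp; linarith, by dsimp; linarith⟩, one_mem_Icc_zero_one,
    div_mem_Icc hB (by nlinarith) (by linarith), one_mem_Icc_zero_one,
    div_mem_Icc hB (by linarith) (by linarith), zero_mem_Icc_zero_one,
    div_mem_Icc hB (by nlinarith) (by linarith), div_mem_Icc hB (by linarith) (by linarith),
    zero_mem_Icc_zero_one, div_mem_Icc hB (by linarith) (by linarith)⟩,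
    rfl, rfl, rfl, rfl, rfl, rfl, rfl, rfl, rfl, rfl, rfl⟩

theorem solution7_nonempty (h : P ∈ Set.Icc P₆ P₉) (hP : 2 ≤ P) : (solution7 P).Nonempty := by
  obtain ⟨hP6, hP9⟩ := h
  rw [P₆_le_iff hP] at hP6
  rw [le_P₉_iff hP] at hP9
  have hP7 : 7 / 2 ≤ P := by nlinarith
  have hP5 : P ≤ 9 / 2 := by nlinarith
  have hB : 0 < P + 1 := by linarith
  have hB' : 0 < (P + 1) ^ 2 := by positivity
  exact ⟨⟨1 / 2, 1 / (P + 1), 1, (4 + 8 * P - 2 * P ^ 2) / (P + 1), 1, 2 / (P + 1), 0,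
    (P - 2) / (P + 1), (2 * P + 1) / (P + 1) ^ 2, (2 * P ^ 2 - 6 * P - 7) / (P + 1),
    (2 * P - 4) / (P + 1)⟩,
    ⟨half_mem_Icc_zero_one, div_mem_Icc hB (by linarith) (by linarith), one_mem_Icc_zero_one,
    div_mem_Icc hB (by nlinarith) (by nlinarith), one_mem_Icc_zero_one,
    div_mem_Icc hB (by linarith) (by linarith), zero_mem_Icc_zero_one,
    div_mem_Icc hB (by linarith) (by linarith), div_mem_Icc hB' (by linarith) (by nlinarith),
    div_mem_Icc hB (by linarith) (by linarith), div_mem_Icc hB (by linarith) (by linarith)⟩,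
    rfl, rfl, rfl, rfl, rfl, rfl, rfl, rfl, rfl, rfl, rfl⟩

theorem solution8_nonempty (h : P ∈ Set.Icc P₈ P₉) (hP : 2 ≤ P) : (solution8 P).Nonempty := by
  obtain ⟨hP8, hP9⟩ := h
  rw [P₈_le_iff hP] at hP8
  rw [le_P₉_iff hP] at hP9
  have hP4 : 4 ≤ P := by nlinarith
  have hP5 : P ≤ 9 / 2 := by nlinarith
  have hB : 0 < P + 1 := by linarith
  exact ⟨⟨(1 / 2) * (9 - 2 * P) * (P + 1), 9 - 2 * P, 1, (4 + 8 * P - 2 * P ^ 2) / (P + 1), 1,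
    2 / (P + 1), 0, (6 + 8 * P - 2 * P ^ 2) / (P + 1), (2 * P - 7) / (P + 1), 1,
    (2 * P - 4) / (P + 1)⟩,
    ⟨⟨mul_nonneg (by linarith) hB.le, by dsimp; linarith⟩,
    ⟨by dsimp; linarith, by dsimp; linarith⟩, one_mem_Icc_zero_one,
    div_mem_Icc hB (by nlinarith) (by linarith), one_mem_Icc_zero_one,
    div_mem_Icc hB (by linarith) (by linarith), zero_mem_Icc_zero_one,
    div_mem_Icc hB (by nlinarith) (by linarith), div_mem_Icc hB (by linarith) (by linarith),
    one_mem_Icc_zero_one, div_mem_Icc hB (by linarith) (by linarith)⟩,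
    rfl, rfl, rfl, rfl, rfl, rfl, rfl, rfl, rfl, rfl, rfl⟩

theorem solution9_nonempty (h : P ∈ Set.Icc P₈ 5) (hP : 2 ≤ P) : (solution9 P).Nonempty := by
  obtain ⟨hP8, hP5⟩ := h
  rw [P₈_le_iff hP] at hP8
  have hP4 : 4 ≤ P := by nlinarith
  have hB : 0 < P + 1 := by linarith
  have hB' : 0 < (P + 1) ^ 2 := by positivity
  have hb := div_mem_Icc hB (show (0 : ℝ) ≤ 2 by norm_num) (by linarith)
  refine ⟨⟨1, 2 / (P + 1), 1, (P - 3) / (P + 1), 1, 2 / (P + 1), 0, (P - 1) / (P + 1),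
    2 * P / (P + 1) ^ 2, 1, (2 * P - 4) / (P + 1)⟩,
    ⟨one_mem_Icc_zero_one, hb, one_mem_Icc_zero_one, div_mem_Icc hB (by linarith) (by linarith),
    one_mem_Icc_zero_one, hb, zero_mem_Icc_zero_one, div_mem_Icc hB (by linarith) (by linarith),
    div_mem_Icc hB' (by linarith) (by nlinarith), one_mem_Icc_zero_one,
    div_mem_Icc hB (by linarith) (by linarith)⟩,
    rfl, rfl, rfl, rfl, rfl, ?_, rfl, rfl, rfl, rfl⟩
  dsimp
  field_simp
  ring

theorem solution10_nonempty (hP : 5 ≤ P) : (solution10 P).Nonempty := by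
  have hB : 0 < P + 1 := by linarith
  have hB' : 0 < (P + 1) ^ 2 := by positivity
  exact ⟨⟨1, 2 / P, (P - 1) / (P + 1), (P - 3) / (P + 1), 1, 2 / (P + 1), (P - 5) / (P + 1), 1,
    2 * P / (P + 1) ^ 2, 1, 1⟩,
    ⟨one_mem_Icc_zero_one, div_mem_Icc (by linarith) (by linarith) (by linarith),
    div_mem_Icc hB (by linarith) (by linarith), div_mem_Icc hB (by linarith) (by linarith),
    one_mem_Icc_zero_one, div_mem_Icc hB (by linarith) (by linarith),
    div_mem_Icc hB (by linarith) (by linarith), one_mem_Icc_zero_one,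
    div_mem_Icc hB' (by linarith) (by nlinarith), one_mem_Icc_zero_one, one_mem_Icc_zero_one⟩,
    rfl, rfl, rfl, rfl, rfl, rfl, rfl, rfl, rfl, rfl, rfl⟩

theorem family_nonempty {k : Label} (hP : 2 ≤ P) (hk : P ∈ validRange k) :
    (family k P).Nonempty := by
  cases k
  exacts [solution1_nonempty hk, solution2_nonempty hk, solution3_nonempty hk hP,
    solution4_nonempty hk hP, solution5_nonempty hk, solution6_nonempty hk hP,
    solution7_nonempty hk hP, solution8_nonempty hk hP, solution9_nonempty hk hP,
    solution10_nonempty hk]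

/-! ### Order of the thresholds, and triple coexistence. -/

theorem three_lt_P₃ : 3 < P₃ :=
  lt_of_not_ge fun h => by linarith [(P₃_le_iff (by norm_num)).1 h]

theorem P₄_lt : P₄ < 7 / 2 :=
  lt_of_not_ge fun h => by linarith [(le_P₄_iff (by norm_num)).1 h]

theorem lt_P₆ : 7 / 2 < P₆ :=
  lt_of_not_ge fun h => by linarith [(P₆_le_iff (by norm_num)).1 h]

theorem P₆_lt_four : P₆ < 4 :=
  lt_of_not_ge fun h => by linarith [(le_P₆_iff (by norm_num)).1 h]

theorem four_lt_P₈ : 4 < P₈ :=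
  lt_of_not_ge fun h => by linarith [(P₈_le_iff (by norm_num)).1 h]

theorem P₉_lt_five : P₉ < 5 :=
  lt_of_not_ge fun h => by linarith [(le_P₉_iff (by norm_num)).1 h]

theorem P₃_lt_P₄ : P₃ < P₄ := by
  have h1 : P₃ ≤ 33 / 10 := (P₃_le_iff (by norm_num)).2 (by norm_num)
  have h2 : 34 / 10 ≤ P₄ := (le_P₄_iff (by norm_num)).2 (by norm_num)
  linarith

theorem P₈_lt_P₉ : P₈ < P₉ := by
  have h1 : P₈ ≤ 435 / 100 := (P₈_le_iff (by norm_num)).2 (by norm_num)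
  have h2 : 44 / 10 ≤ P₉ := (le_P₉_iff (by norm_num)).2 (by norm_num)
  linarith

theorem disjoint_solution2 {S : Set Profile} (hP : 2 ≤ P) (h : P < P₄)
    (hS : ∀ σ ∈ S, σ.d₂ = 0) : Disjoint (solution2 P) S := by
  refine Set.disjoint_left.2 fun σ ⟨_, _, _, _, _, _, _, hd, _⟩ hσ => ?_
  rw [hS σ hσ, eq_div_iff (by linarith)] at hd
  exact h.not_ge ((P₄_le_iff hP).2 (by linarith))

/-- A common point would make `(5 - P) / 2` a root of the quadratic of family 3, which happens only
at `P₃`. -/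
theorem disjoint_solution3_solution4 (hP : 2 ≤ P) (h : P₃ < P) :
    Disjoint (solution3 P) (solution4 P) := by
  refine Set.disjoint_left.2 fun σ ⟨_, _, _, ha, _⟩ ⟨_, _, _, ha', _⟩ => ?_
  have hq := betRoot_quadratic hP
  change σ.a₂ = betRoot P at ha
  rw [← ha, ha'] at hq
  have h1 : (P + 1) * (3 * P + 11 - 2 * P ^ 2) = 0 := by linear_combination (-4) * hq
  rcases mul_eq_zero.1 h1 with h1 | h1
  · linarith
  · exact h.not_ge ((le_P₃_iff hP).2 (by linarith))

theorem disjoint_of_a₁_ne {S T : Set Profile} {x y : ℝ} (hS : ∀ σ ∈ S, σ.a₁ = x)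
    (hT : ∀ σ ∈ T, σ.a₁ = y) (hxy : x ≠ y) : Disjoint S T :=
  Set.disjoint_left.2 fun σ hσ hσ' => hxy ((hS σ hσ).symm.trans (hT σ hσ'))

theorem nashSet_eq_union {i j k : Label} (hP : 2 ≤ P) (hi : P ∈ validRange i)
    (hj : P ∈ validRange j) (hk : P ∈ validRange k)
    (hl : ∀ l, P ∈ validRange l → l = i ∨ l = j ∨ l = k)
    (h2 : P ≠ 2) (h3 : P ≠ 3) (h7 : P ≠ 7 / 2) (h5 : P ≠ 5) :
    nashSet P = family i P ∪ family j P ∪ family k P := by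
  apply Set.Subset.antisymm
  · intro σ hσ
    rcases (isNash_iff_isListed hP).1 hσ with ⟨l, hlP, hσl⟩ | h | h | h | h
    · rcases hl l hlP with rfl | rfl | rfl
      · exact Or.inl (Or.inl hσl)
      · exact Or.inl (Or.inr hσl)
      · exact Or.inr hσl
    exacts [absurd h.1 h2, absurd h.1 h3, absurd h.1 h7, absurd h.1 h5]
  · exact Set.union_subset (Set.union_subset (family_subset_nashSet hP hi)
      (family_subset_nashSet hP hj)) (family_subset_nashSet hP hk)

theorem label_of_mem_P₃_P₄ (h : P ∈ Set.Icc P₃ P₄) (l : Label) (hl : P ∈ validRange l) :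
    l = .s2 ∨ l = .s3 ∨ l = .s4 := by
  obtain ⟨h0, h1⟩ := h
  have := three_lt_P₃
  have := P₄_lt
  have := lt_P₆
  have := four_lt_P₈
  have := P₆_lt_four
  cases l <;> simp only [validRange, Set.mem_Icc, Set.mem_Ici] at hl <;>
    first | (exfalso; linarith) | simp

theorem label_of_mem_P₆_four (h : P ∈ Set.Icc P₆ 4) (l : Label) (hl : P ∈ validRange l) :
    l = .s5 ∨ l = .s6 ∨ l = .s7 := by
  obtain ⟨h0, h1⟩ := h
  have := P₄_lt
  have := lt_P₆
  have := four_lt_P₈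
  cases l <;> simp only [validRange, Set.mem_Icc, Set.mem_Ici] at hl <;>
    first | (exfalso; linarith) | simp

theorem label_of_mem_P₈_P₉ (h : P ∈ Set.Icc P₈ P₉) (l : Label) (hl : P ∈ validRange l) :
    l = .s7 ∨ l = .s8 ∨ l = .s9 := by
  obtain ⟨h0, h1⟩ := h
  have := P₄_lt
  have := four_lt_P₈
  have := P₉_lt_five
  cases l <;> simp only [validRange, Set.mem_Icc, Set.mem_Ici] at hl <;>
    first | (exfalso; linarith) | simp

theorem threeCoexist_two_three_four (h : P ∈ Set.Ioo P₃ P₄) : ThreeCoexist P .s2 .s3 .s4 := by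
  obtain ⟨h0, h1⟩ := h
  have := three_lt_P₃
  have := P₄_lt
  have hP : 2 ≤ P := by linarith
  have r2 : P ∈ validRange .s2 := ⟨by linarith, h1.le⟩
  have r3 : P ∈ validRange .s3 := ⟨h0.le, h1.le⟩
  have r4 : P ∈ validRange .s4 := ⟨h0.le, by linarith⟩
  exact ⟨nashSet_eq_union hP r2 r3 r4 (label_of_mem_P₃_P₄ ⟨h0.le, h1.le⟩) (by linarith)
    (by linarith) (by linarith) (by linarith), family_nonempty hP r2, family_nonempty hP r3,
    family_nonempty hP r4,
    disjoint_solution2 hP h1 fun σ ⟨_, _, _, _, _, _, _, hd, _⟩ => hd,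
    disjoint_solution2 hP h1 fun σ ⟨_, _, _, _, _, _, _, hd, _⟩ => hd,
    disjoint_solution3_solution4 hP h0⟩

theorem threeCoexist_five_six_seven (h : P ∈ Set.Ioo P₆ 4) : ThreeCoexist P .s5 .s6 .s7 := by
  obtain ⟨h0, h1⟩ := h
  have := lt_P₆
  have := four_lt_P₈
  have := P₈_lt_P₉
  have hP : 2 ≤ P := by linarith
  have r5 : P ∈ validRange .s5 := ⟨by linarith, h1.le⟩
  have r6 : P ∈ validRange .s6 := ⟨h0.le, h1.le⟩
  have r7 : P ∈ validRange .s7 := ⟨h0.le, by linarith⟩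
  refine ⟨nashSet_eq_union hP r5 r6 r7 (label_of_mem_P₆_four ⟨h0.le, h1.le⟩) (by linarith)
    (by linarith) (by linarith) (by linarith), family_nonempty hP r5, family_nonempty hP r6,
    family_nonempty hP r7, disjoint_of_a₁_ne (fun σ hσ => hσ.2.1) (fun σ hσ => hσ.2.1) ?_,
    disjoint_of_a₁_ne (fun σ hσ => hσ.2.1) (fun σ hσ => hσ.2.1) (by norm_num),
    disjoint_of_a₁_ne (fun σ hσ => hσ.2.1) (fun σ hσ => hσ.2.1) fun he => ?_⟩
  · exact (mul_pos (by linarith) (by linarith)).ne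
  · exact h0.not_ge ((le_P₆_iff hP).2 (by linarith))

theorem threeCoexist_seven_eight_nine (h : P ∈ Set.Ioo P₈ P₉) :
    ThreeCoexist P .s7 .s8 .s9 := by
  obtain ⟨h0, h1⟩ := h
  have := P₆_lt_four
  have := four_lt_P₈
  have := P₉_lt_five
  have hP : 2 ≤ P := by linarith
  have r7 : P ∈ validRange .s7 := ⟨by linarith, h1.le⟩
  have r8 : P ∈ validRange .s8 := ⟨h0.le, h1.le⟩
  have r9 : P ∈ validRange .s9 := ⟨h0.le, by linarith⟩
  refine ⟨nashSet_eq_union hP r7 r8 r9 (label_of_mem_P₈_P₉ ⟨h0.le, h1.le⟩) (by linarith)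
    (by linarith) (by linarith) (by linarith), family_nonempty hP r7, family_nonempty hP r8,
    family_nonempty hP r9,
    disjoint_of_a₁_ne (fun σ hσ => hσ.2.1) (fun σ hσ => hσ.2.1) fun he => ?_,
    disjoint_of_a₁_ne (fun σ hσ => hσ.2.1) (fun σ hσ => hσ.2.1) (by norm_num),
    disjoint_of_a₁_ne (fun σ hσ => hσ.2.1) (fun σ hσ => hσ.2.1) fun he => ?_⟩
  · exact h1.not_ge ((P₉_le_iff hP).2 (by linarith))
  · exact h0.not_ge ((le_P₈_iff hP).2 (by linarith))

/-! ### Inclusions at the thresholds, and absence of further triples. -/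

/-- The equation says `P = P₃`. The bound `P ≤ 5` makes `a₂` nonnegative, which selects the larger
root of the quadratic. -/
theorem solution4_subset_solution3 (hP : 2 ≤ P) (hP5 : P ≤ 5) (h : 2 * P ^ 2 = 3 * P + 11) :
    solution4 P ⊆ solution3 P := by
  rintro σ ⟨hf, ha₁, hb₁, ha₂, hb₂, hb₃, hc₁, hd₂, hc₃, hd₁, hx, hx'⟩
  have hB : 0 < P + 1 := by linarith
  have hB' : 0 < 3 * (P + 1) := by linarith
  have e2 := (eq_div_iff hB.ne').1 hb₂
  have e3 := (eq_div_iff hB'.ne').1 hb₃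
  refine ⟨hf, ha₁, hb₁, eq_root_of_quadratic hP (by linarith) ?_, ?_, ?_, ?_, hd₂, hc₃, hd₁, hx,
    hx'.trans_eq ?_⟩
  · rw [ha₂]
    linear_combination (P + 1) / 4 * h
  · rw [hb₂, ha₂]
    ring
  · rw [eq_div_iff (by linarith), ha₂]
    apply mul_left_cancel₀ hB'.ne'
    linear_combination (P + 5) / 2 * e3 + 3 * e2 + h
  · rw [hc₁, ha₂, eq_div_iff hB.ne']
    ring
  · rw [div_eq_iff hB'.ne']
    linarith

theorem solution2_subset_solution3 (hP : 2 ≤ P) (h : 2 * P ^ 2 = 6 * P + 3) :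
    solution2 P ⊆ solution3 P := by
  rintro σ ⟨hf, ha₁, hb₁, ha₂, hb₂, hb₃, hc₁, hd₂, hc₃, hd₁, hx, hx'⟩
  have hB : 0 < P + 1 := by linarith
  have e2 := (eq_div_iff hB.ne').1 hb₂
  have e3 := (eq_div_iff hB.ne').1 hb₃
  refine ⟨hf, ha₁, hb₁, eq_root_of_quadratic hP (by linarith) ?_, ?_, ?_, ?_, ?_, hc₃, hd₁, hx,
    hx'.trans_eq ?_⟩
  · rw [ha₂]
    linear_combination (2 * P + 1) / 4 * h
  · rw [hb₂, ha₂]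
    ring
  · rw [eq_div_iff (by linarith), ha₂]
    apply mul_left_cancel₀ hB.ne'
    linear_combination (P + 1 / 2) * e3 + e2
  · rw [hc₁, ha₂, eq_div_iff hB.ne']
    linarith
  · rw [hd₂, div_eq_iff hB.ne']
    linarith
  · rw [div_eq_iff hB.ne']
    linarith

theorem solution6_subset_solution7 (hP : 2 ≤ P) (h : 2 * P ^ 2 = 6 * P + 7) :
    solution6 P ⊆ solution7 P := by
  rintro σ ⟨hf, ha₁, hb₁, ha₂, hb₂, hb₃, hc₁, hd₂, hc₃, hd₁, hc₂, hd₃⟩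
  have hB : 0 < P + 1 := by linarith
  refine ⟨hf, by linarith, ?_, ha₂, hb₂, ?_, hc₁, ?_, ?_, hd₁, hc₂, hd₃⟩
  · rw [hb₁, eq_div_iff hB.ne']
    linarith
  · rw [hb₃, div_eq_div_iff hB.ne' (by positivity)]
    linear_combination (P + 1) * h
  · rw [hd₂]
    congr 1
    linarith
  · rw [hc₃, eq_div_iff hB.ne']
    linarith

theorem solution8_subset_solution7 (hP : 2 ≤ P) (h : 2 * P ^ 2 = 7 * P + 8) :
    solution8 P ⊆ solution7 P := by
  rintro σ ⟨hf, ha₁, hb₁, ha₂, hb₂, hb₃, hc₁, hd₂, hc₃, hd₁, hc₂, hd₃⟩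
  have hB : 0 < P + 1 := by linarith
  refine ⟨hf, by linarith, ?_, ha₂, hb₂, ?_, hc₁, ?_, ?_, hd₁, hc₂, hd₃⟩
  · rw [hb₁, eq_div_iff hB.ne']
    linarith
  · rw [hb₃, div_eq_div_iff hB.ne' (by positivity)]
    linear_combination (P + 1) * h
  · rw [hd₂]
    congr 1
    linarith
  · rw [hc₃, eq_div_iff hB.ne']
    linarith

theorem solution8_subset_solution9 (hP : 2 ≤ P) (h : 2 * P ^ 2 = 7 * P + 7) :
    solution8 P ⊆ solution9 P := by
  rintro σ ⟨hf, ha₁, hb₁, ha₂, hb₂, hb₃, hc₁, hd₂, hc₃, hd₁, hc₂, hd₃⟩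
  have hB : 0 < P + 1 := by linarith
  refine ⟨hf, by linarith, ?_, ha₂, hb₂, ?_, ?_, hc₃, ?_, hc₂, hd₃⟩
  · rw [hb₁, eq_div_iff hB.ne']
    linarith
  · rw [hb₃, div_eq_div_iff hB.ne' (by positivity)]
    linear_combination (P + 1) * h
  · rw [eq_div_iff hB.ne'] at hd₂ ⊢
    rw [hc₁]
    linarith
  · rw [hd₁]
    congr 1
    linarith

theorem solution6_four_subset_solution5 : solution6 4 ⊆ solution5 4 := by
  rintro σ ⟨hf, ha₁, hb₁, ha₂, hb₂, hb₃, hc₁, hd₂, hc₃, hd₁, hc₂, hd₃⟩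
  refine ⟨hf, by linarith, by linarith, ha₂, hb₂, by linarith, hc₁, by linarith, hc₃, by linarith,
    by linarith, by linarith⟩

/-- If all but one of the families valid at `P` have a point in common, no three of them are
pairwise disjoint. -/
theorem not_three_disjoint {i j k r : Label} (hP : 2 ≤ P)
    (hl : ∀ l, P ∈ validRange l → l = r ∨ σ ∈ family l P)
    (hi : P ∈ validRange i) (hj : P ∈ validRange j) (hk : P ∈ validRange k)
    (hij : Disjoint (family i P) (family j P)) (hik : Disjoint (family i P) (family k P))
    (hjk : Disjoint (family j P) (family k P)) : False := by
  have key : ∀ l m, P ∈ validRange l → Disjoint (family l P) (family m P) → l ≠ m := by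
    rintro l m hl hd rfl
    exact (family_nonempty hP hl).ne_empty (disjoint_self.1 hd)
  have nij := key i j hi hij
  have nik := key i k hi hik
  have njk := key j k hj hjk
  rcases hl i hi with rfl | si
  · exact Set.disjoint_left.1 hjk ((hl j hj).resolve_left nij.symm)
      ((hl k hk).resolve_left nik.symm)
  · have hj' := (hl j hj).resolve_right fun sj => Set.disjoint_left.1 hij si sj
    have hk' := (hl k hk).resolve_right fun sk => Set.disjoint_left.1 hik si sk
    exact njk (hj'.trans hk'.symm)

theorem not_three_disjoint_of_two {i j k p q : Label} (hP : 2 ≤ P)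
    (hl : ∀ l, P ∈ validRange l → l = p ∨ l = q)
    (hi : P ∈ validRange i) (hj : P ∈ validRange j) (hk : P ∈ validRange k)
    (hij : Disjoint (family i P) (family j P)) (hik : Disjoint (family i P) (family k P))
    (hjk : Disjoint (family j P) (family k P)) : False := by
  obtain ⟨σ, hσ⟩ := family_nonempty hP hi
  have : ∃ r, ∀ l, P ∈ validRange l → l = r ∨ σ ∈ family l P := by
    rcases hl i hi with rfl | rfl
    · exact ⟨q, fun l h => (hl l h).elim (fun e => Or.inr (e ▸ hσ)) Or.inl⟩
    · exact ⟨p, fun l h => (hl l h).elim Or.inl fun e => Or.inr (e ▸ hσ)⟩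
  obtain ⟨r, hr⟩ := this
  exact not_three_disjoint hP hr hi hj hk hij hik hjk

theorem mem_of_three_disjoint {i j k : Label} (hP : 2 ≤ P)
    (hi : P ∈ validRange i) (hj : P ∈ validRange j) (hk : P ∈ validRange k)
    (hij : Disjoint (family i P) (family j P)) (hik : Disjoint (family i P) (family k P))
    (hjk : Disjoint (family j P) (family k P)) :
    P ∈ Set.Ioo P₃ P₄ ∪ Set.Ioo P₆ 4 ∪ Set.Ioo P₈ P₉ := by
  have h3 := three_lt_P₃
  have h34 := P₃_lt_P₄
  have h4 := P₄_lt
  have h6 := lt_P₆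
  have h64 := P₆_lt_four
  have h8 := four_lt_P₈
  have h89 := P₈_lt_P₉
  have h9 := P₉_lt_five
  have one : ∀ {r : Label} {σ : Profile},
      (∀ l, P ∈ validRange l → l = r ∨ σ ∈ family l P) → False :=
    fun hl => not_three_disjoint hP hl hi hj hk hij hik hjk
  have two : ∀ p q : Label, (∀ l, P ∈ validRange l → l = p ∨ l = q) → False :=
    fun p q hl => not_three_disjoint_of_two hP hl hi hj hk hij hik hjk
  rcases lt_trichotomy P P₃ with hlt | heq | hgt
  · refine (two .s1 .s2 fun l hl => ?_).elim
    cases l <;> simp only [validRange, Set.mem_Icc, Set.mem_Ici] at hl <;>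
      first | (exfalso; linarith) | simp
  · have he : 2 * P ^ 2 = 3 * P + 11 :=
      ((le_P₃_iff hP).1 heq.le).antisymm ((P₃_le_iff hP).1 heq.ge)
    have r4 : P ∈ validRange .s4 := ⟨heq.ge, by linarith⟩
    obtain ⟨σ, hσ⟩ := family_nonempty hP r4
    refine (one (r := .s2) (σ := σ) fun l hl => ?_).elim
    rcases label_of_mem_P₃_P₄ ⟨heq.ge, by linarith⟩ l hl with rfl | rfl | rfl
    exacts [Or.inl rfl, Or.inr (solution4_subset_solution3 hP (by linarith) he hσ), Or.inr hσ]
  rcases lt_trichotomy P P₄ with hlt | heq | hgt'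
  · exact Or.inl (Or.inl ⟨hgt, hlt⟩)
  · have he : 2 * P ^ 2 = 6 * P + 3 :=
      ((le_P₄_iff hP).1 heq.le).antisymm ((P₄_le_iff hP).1 heq.ge)
    have r2 : P ∈ validRange .s2 := ⟨by linarith, heq.le⟩
    obtain ⟨σ, hσ⟩ := family_nonempty hP r2
    refine (one (r := .s4) (σ := σ) fun l hl => ?_).elim
    rcases label_of_mem_P₃_P₄ ⟨hgt.le, heq.le⟩ l hl with rfl | rfl | rfl
    exacts [Or.inr hσ, Or.inr (solution2_subset_solution3 hP he hσ), Or.inl rfl]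
  rcases lt_trichotomy P P₆ with hlt | heq | hgt
  · refine (two .s4 .s5 fun l hl => ?_).elim
    cases l <;> simp only [validRange, Set.mem_Icc, Set.mem_Ici] at hl <;>
      first | (exfalso; linarith) | simp
  · have he : 2 * P ^ 2 = 6 * P + 7 :=
      ((le_P₆_iff hP).1 heq.le).antisymm ((P₆_le_iff hP).1 heq.ge)
    have r6 : P ∈ validRange .s6 := ⟨heq.ge, by linarith⟩
    obtain ⟨σ, hσ⟩ := family_nonempty hP r6
    refine (one (r := .s5) (σ := σ) fun l hl => ?_).elim
    rcases label_of_mem_P₆_four ⟨heq.ge, by linarith⟩ l hl with rfl | rfl | rfl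
    exacts [Or.inl rfl, Or.inr hσ, Or.inr (solution6_subset_solution7 hP he hσ)]
  rcases lt_trichotomy P 4 with hlt | rfl | hgt'
  · exact Or.inl (Or.inr ⟨hgt, hlt⟩)
  · have r6 : (4 : ℝ) ∈ validRange .s6 := ⟨hgt.le, le_rfl⟩
    obtain ⟨σ, hσ⟩ := family_nonempty hP r6
    refine (one (r := .s7) (σ := σ) fun l hl => ?_).elim
    rcases label_of_mem_P₆_four ⟨hgt.le, le_rfl⟩ l hl with rfl | rfl | rfl
    exacts [Or.inr (solution6_four_subset_solution5 hσ), Or.inr hσ, Or.inl rfl]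
  rcases lt_trichotomy P P₈ with hlt | heq | hgt
  -- Between 4 and `P₈` only family 7 is valid, hence the repeated label.
  · refine (two .s7 .s7 fun l hl => ?_).elim
    cases l <;> simp only [validRange, Set.mem_Icc, Set.mem_Ici] at hl <;>
      first | (exfalso; linarith) | simp
  · have he : 2 * P ^ 2 = 7 * P + 7 :=
      ((le_P₈_iff hP).1 heq.le).antisymm ((P₈_le_iff hP).1 heq.ge)
    have r8 : P ∈ validRange .s8 := ⟨heq.ge, by linarith⟩
    obtain ⟨σ, hσ⟩ := family_nonempty hP r8
    refine (one (r := .s7) (σ := σ) fun l hl => ?_).elim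
    rcases label_of_mem_P₈_P₉ ⟨heq.ge, by linarith⟩ l hl with rfl | rfl | rfl
    exacts [Or.inl rfl, Or.inr hσ, Or.inr (solution8_subset_solution9 hP he hσ)]
  rcases lt_trichotomy P P₉ with hlt | heq | hgt'
  · exact Or.inr ⟨hgt, hlt⟩
  · have he : 2 * P ^ 2 = 7 * P + 8 :=
      ((le_P₉_iff hP).1 heq.le).antisymm ((P₉_le_iff hP).1 heq.ge)
    have r8 : P ∈ validRange .s8 := ⟨hgt.le, heq.le⟩
    obtain ⟨σ, hσ⟩ := family_nonempty hP r8
    refine (one (r := .s9) (σ := σ) fun l hl => ?_).elim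
    rcases label_of_mem_P₈_P₉ ⟨hgt.le, heq.le⟩ l hl with rfl | rfl | rfl
    exacts [Or.inr (solution8_subset_solution7 hP he hσ), Or.inr hσ, Or.inl rfl]
  · refine (two .s9 .s10 fun l hl => ?_).elim
    cases l <;> simp only [validRange, Set.mem_Icc, Set.mem_Ici] at hl <;>
      first | (exfalso; linarith) | simp

end Families

end Kuhn

theorem mainTheorem1 :
    -- the complete list of equilibria, for every pot size `P ≥ 2`
    (∀ P : ℝ, 2 ≤ P → ∀ σ : Kuhn.Profile, Kuhn.IsNash P σ ↔
      (∃ k : Kuhn.Label, P ∈ Kuhn.validRange k ∧ σ ∈ Kuhn.family k P) ∨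
      (P = 2 ∧ σ ∈ Kuhn.solution1a) ∨
      (P = 3 ∧ σ ∈ Kuhn.solution2a) ∨
      (P = 7 / 2 ∧ σ ∈ Kuhn.solution5a) ∨
      (P = 5 ∧ σ ∈ Kuhn.solution10a)) ∧
    -- each family is valid exactly on its range
    (∀ P : ℝ, 2 ≤ P → ∀ k : Kuhn.Label,
      (P ∈ Kuhn.validRange k →
        (Kuhn.family k P).Nonempty ∧ Kuhn.family k P ⊆ Kuhn.nashSet P) ∧
      (P ∉ Kuhn.validRange k → Disjoint (Kuhn.family k P) (Kuhn.nashSet P))) ∧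
    -- the three ranges of pot sizes with three coexisting equilibria
    (∀ P ∈ Set.Ioo Kuhn.P₃ Kuhn.P₄, Kuhn.ThreeCoexist P .s2 .s3 .s4) ∧
    (∀ P ∈ Set.Ioo Kuhn.P₆ 4, Kuhn.ThreeCoexist P .s5 .s6 .s7) ∧
    (∀ P ∈ Set.Ioo Kuhn.P₈ Kuhn.P₉, Kuhn.ThreeCoexist P .s7 .s8 .s9) ∧
    -- and there are no others
    (∀ P : ℝ, 2 ≤ P → ∀ i j k : Kuhn.Label,
      P ∈ Kuhn.validRange i → P ∈ Kuhn.validRange j → P ∈ Kuhn.validRange k →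
      Disjoint (Kuhn.family i P) (Kuhn.family j P) →
      Disjoint (Kuhn.family i P) (Kuhn.family k P) →
      Disjoint (Kuhn.family j P) (Kuhn.family k P) →
      P ∈ Set.Ioo Kuhn.P₃ Kuhn.P₄ ∪ Set.Ioo Kuhn.P₆ 4 ∪ Set.Ioo Kuhn.P₈ Kuhn.P₉) := by
  exact ⟨fun P hP σ => Kuhn.isNash_iff_isListed hP,
    fun P hP k => ⟨fun hk => ⟨Kuhn.family_nonempty hP hk, Kuhn.family_subset_nashSet hP hk⟩,
      fun hk => Set.disjoint_left.2 fun σ hσ hN => hk (Kuhn.mem_validRange hP hσ hN)⟩,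
    fun P => Kuhn.threeCoexist_two_three_four, fun P => Kuhn.threeCoexist_five_six_seven,
    fun P => Kuhn.threeCoexist_seven_eight_nine,
    fun P hP i j k => Kuhn.mem_of_three_disjoint hP⟩
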